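/- Let $R=\mathbb{Q}[[\mathbf x,\mathbf y]]$ be the ring of formal power series in $x_1,x_2,\dots$ and $y_1,y_2,\dots$, with the topology of coefficientwise convergence (discrete coefficients). A *generalized bicomposition* $\tilde\alpha$ is a sequence of columns $(\tilde\alpha_{1j},\tilde\alpha_{2j})\in\mathbb{N}^2$, $j\ge 1$, almost all equal to $(0,0)$; its length $\ell(\tilde\alpha)$ is the index of its last nonzero column ($0$ if there is none), and $\mathbf X^{\tilde\alpha}=\prod_j x_j^{\tilde\alpha_{1j}}y_j^{\tilde\alpha_{2j}}$. It is a *bicomposition* if its columns $1,\dots,\ell(\tilde\alpha)$ are all nonzero. For a bicomposition $\alpha$ of length $k$ put $$M_\alpha=\sum_{i_1<\dots<i_k}x_{i_1}^{\alpha_{11}}y_{i_1}^{\alpha_{21}}\cdots x_{i_k}^{\alpha_{1k}}y_{i_k}^{\alpha_{2k}}.$$ Let $\mathsf{DQSym}$ be the span of all $M_\alpha$, let $\mathsf{DQSym}^+$ be the set of its elements without constant term, and let $I$ be the closure in $R$ of the ideal generated by $\mathsf{DQSym}^+$. Let $\preceq$ be the partial order on bicompositions generated by: $\alpha\preceq\beta$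 if $\beta$ arises from $\alpha$ by replacing two adjacent columns $k,k+1$ with $1\le k<\ell(\alpha)$, such that $\alpha_{2k}=0$ or $\alpha_{1(k+1)}=0$, by their sum. Put $F_\beta=\sum_{\alpha\preceq\beta}M_\alpha$, so $F_0=1$. Define $G_{\tilde\epsilon}\in R$ for all generalized bicompositions by recursion on the length. If $\tilde\epsilon$ is a bicomposition, $G_{\tilde\epsilon}=F_{\tilde\epsilon}$. Otherwise $\tilde\epsilon$ consists of $k\geq 0$ columns $\tilde\alpha$, then a zero column, then a nonzero bicomposition $\beta$, and $$G_{\tilde\epsilon}=G_{\tilde\alpha\beta}-x_{k+1}G_{\tilde\alpha\beta'}\ \text{ if }\beta_{11}>0,\qquad G_{\tilde\epsilon}=G_{\tilde\alpha\beta}-y_{k+1}G_{\tilde\alpha\beta''}\ \text{ if }\beta_{11}=0,$$ where $\beta'$ (resp. $\beta''$) is $\beta$ with the entry $\beta_{11}$ (resp. $\beta_{21}$) lowered by one, and $\tilde\alpha\beta$ is the $k$ columns $\tilde\alpha$ followed by $\beta$. For $i\ge1$ and a generalized bicomposition $\tilde\gamma$ define $\phi(x_i,\tilde\gamma)$ and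 $\phi(y_i,\tilde\gamma)$ by replacing column $i$ of $\tilde\gamma$, say $\binom{a}{b}$, as follows (the later columns move to the right): * for $\phi(x_i,\tilde\gamma)$, by the two columns $\binom{0}{0}\binom{a+1}{b}$; * for $\phi(y_i,\tilde\gamma)$, by the two columns $\binom{0}{0}\binom{0}{b+1}$ if $a=0$, and by the three columns $\binom{0}{0}\binom{0}{1}\binom{a}{b}$ if $a>0$. For a generalized bicomposition $\tilde\alpha$ and a bicomposition $\beta\neq0$ let $\Phi(\mathbf X^{\tilde\alpha}F_\beta)=G_{\tilde\gamma}$, where $\tilde\gamma$ is obtained from $\beta$ by applying $\phi(y_1,\cdot)$ $\tilde\alpha_{21}$ times, then $\phi(x_1,\cdot)$ $\tilde\alpha_{11}$ times, then $\phi(y_2,\cdot)$ $\tilde\alpha_{22}$ times, then $\phi(x_2,\cdot)$ $\tilde\alpha_{12}$ times, and so on. **Theorem.** The set $A=\{G_{\tilde\alpha}\mid G_{\tilde\alpha}\notin\operatorname{Img}(\Phi)\}$ is a Hilbert basis of the quotient space $R/I$, in the following sense: the classes in $R/I$ of the elements of $A$ are (pairwise distinct and) linearly independent over $\mathbb{Q}$;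 the class of every polynomial $p\in\mathbb{Q}[\mathbf x,\mathbf y]$ is a finite linear combination of them; and their linear span is dense in $R/I$. -/

import Mathlib

/-! Diagonally quasi-symmetric functions in `ℚ⟦x₁, x₂, …, y₁, y₂, …⟧`.

Columns and variables are numbered from `0`: `x j`, `y j` and column `j` of a generalized
bicomposition are the usual `x_{j+1}`, `y_{j+1}` and `(j+1)`-st column. -/

noncomputable section

namespace DQSym

/-- The ring `ℚ⟦x, y⟧`; `Sum.inl j` is the index of `x j` and `Sum.inr j` that of `y j`. -/
abbrev R : Type := MvPowerSeries (ℕ ⊕ ℕ) ℚ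

/-- The usual topology on formal power series: coefficientwise convergence, with discrete
coefficients. -/
instance instTopologicalSpaceR : TopologicalSpace R :=
  @MvPowerSeries.WithPiTopology.instTopologicalSpace (ℕ ⊕ ℕ) ℚ ⊥

instance instIsTopologicalRingR : IsTopologicalRing R :=
  letI : TopologicalSpace ℚ := ⊥
  haveI : DiscreteTopology ℚ := ⟨rfl⟩
  MvPowerSeries.WithPiTopology.instIsTopologicalRing (ℕ ⊕ ℕ) ℚ

def x (j : ℕ) : R := MvPowerSeries.X (Sum.inl j)

def y (j : ℕ) : R := MvPowerSeries.X (Sum.inr j)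

/-- Generalized bicompositions: sequences of columns `(α₁ⱼ, α₂ⱼ)`, almost all of them `(0, 0)`. -/
abbrev GBicomp : Type := ℕ →₀ ℕ × ℕ

/-- The length: the number of columns up to the last nonzero one. -/
def len (α : GBicomp) : ℕ := α.support.sup (fun j => j + 1)

/-- A bicomposition has no zero column before its last nonzero one. -/
def IsBicomp (α : GBicomp) : Prop := ∀ j < len α, α j ≠ 0

/-- The exponent vector of the monomial `X^α = ∏ⱼ xⱼ^{α₁ⱼ} yⱼ^{α₂ⱼ}`. -/
def expo (α : GBicomp) : ℕ ⊕ ℕ →₀ ℕ :=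
  α.sum fun j c => Finsupp.single (Sum.inl j) c.1 + Finsupp.single (Sum.inr j) c.2

/-- The function `M_α`: the sum of the distinct monomials obtained from `X^α` by moving its
columns to positions `i₁ < i₂ < ⋯`. -/
def M (α : GBicomp) : R := fun m =>
  open Classical in
  if ∃ i : ℕ → ℕ, StrictMono i ∧ m = expo (α.mapDomain i) then 1 else 0

/-- Add up columns `k` and `k + 1`. -/
def merge (k : ℕ) (α : GBicomp) : GBicomp := α.mapDomain (fun j => if j ≤ k then j else j - 1)

/-- `β` covers `α`: two adjacent columns of `α` are added up, the left one without `y` or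
the right one without `x`. -/
def Covers (α β : GBicomp) : Prop :=
  IsBicomp α ∧ ∃ k, k + 1 < len α ∧ ((α k).2 = 0 ∨ (α (k + 1)).1 = 0) ∧ β = merge k α

/-- The partial order on bicompositions that `Covers` generates. -/
def Refines : GBicomp → GBicomp → Prop := Relation.ReflTransGen Covers

/-- The size: the sum of all entries. -/
def size (α : GBicomp) : ℕ := α.sum fun _ c => c.1 + c.2

theorem lt_len {α : GBicomp} {j : ℕ} (h : α j ≠ 0) : j < len α :=
  Finset.le_sup (f := fun j => j + 1) (Finsupp.mem_support_iff.2 h)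

theorem size_merge (k : ℕ) (α : GBicomp) : size (merge k α) = size α := by
  unfold size merge
  exact Finsupp.sum_mapDomain_index (fun _ => rfl)
    (fun _ a b => by simp only [Prod.fst_add, Prod.snd_add]; omega)

theorem finite_isBicomp (n : ℕ) : {α : GBicomp | IsBicomp α ∧ size α = n}.Finite := by
  refine (Finset.finite_toSet ((Finset.range n).finsupp
    fun _ => Finset.range (n + 1) ×ˢ Finset.range (n + 1))).subset ?_
  rintro α ⟨hα, hn⟩
  have hle : ∀ j, (α j).1 + (α j).2 ≤ n := by
    intro j
    by_cases h : α j = 0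
    · simp [h]
    · rw [← hn]
      exact Finset.single_le_sum (f := fun j => (α j).1 + (α j).2) (fun _ _ => Nat.zero_le _)
        (Finsupp.mem_support_iff.2 h)
  have hlen : len α ≤ n := by
    calc len α = ∑ _j ∈ Finset.range (len α), 1 := by simp
      _ ≤ ∑ j ∈ Finset.range (len α), ((α j).1 + (α j).2) := by
          refine Finset.sum_le_sum fun j hj => ?_
          have h := hα j (Finset.mem_range.1 hj)
          by_contra hc
          exact h (Prod.ext (by simp only [Prod.fst_zero]; omega)
            (by simp only [Prod.snd_zero]; omega))
      _ = n := by
          rw [← hn]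
          exact (Finset.sum_subset (fun j hj => Finset.mem_range.2
            (lt_len (Finsupp.mem_support_iff.1 hj)))
            (fun j _ hj => by simp [Finsupp.notMem_support_iff.1 hj])).symm
  refine Finset.mem_coe.2 (Finset.mem_finsupp_iff.2 ⟨fun j hj => Finset.mem_range.2
    ((lt_len (Finsupp.mem_support_iff.1 hj)).trans_le hlen), fun j _ => ?_⟩)
  have := hle j
  simp only [Finset.mem_product, Finset.mem_range]
  omega

theorem finite_refines (β : GBicomp) : {α : GBicomp | Refines α β}.Finite := by
  refine ((finite_isBicomp (size β)).union (Set.finite_singleton β)).subset ?_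
  intro α h
  induction h using Relation.ReflTransGen.head_induction_on with
  | refl => exact Or.inr rfl
  | head h _ ih =>
    obtain ⟨hb, k, -, -, rfl⟩ := h
    refine Or.inl ⟨hb, ?_⟩
    rw [← size_merge k]
    rcases ih with ih | ih
    · exact ih.2
    · rw [Set.mem_singleton_iff.1 ih]

/-- `F_β = ∑_{α ≼ β} M_α` (a finite sum, see `finite_refines`). -/
def F (β : GBicomp) : R := ∑ᶠ α ∈ {α : GBicomp | Refines α β}, M α

/-- The diagonally quasi-symmetric functions. -/
def diagQSym : Submodule ℚ R := Submodule.span ℚ {f | ∃ α, IsBicomp α ∧ f = M α}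

/-- The closure of the ideal generated by the diagonally quasi-symmetric functions without
constant term. -/
def I : Ideal R := (Ideal.span {f | f ∈ diagQSym ∧ MvPowerSeries.constantCoeff f = 0}).closure

/-- The increasing enumeration of `ℕ` without `k`. -/
def skip (k j : ℕ) : ℕ := if j < k then j else j + 1

theorem skip_injective (k : ℕ) : Function.Injective (skip k) := by
  intro a b h
  unfold skip at h
  split_ifs at h <;> omega

/-- Insert a zero column at position `k`. -/
def insertZero (k : ℕ) (α : GBicomp) : GBicomp := α.mapDomain (skip k)

/-- Remove column `k`. -/
def deleteCol (k : ℕ) (α : GBicomp) : GBicomp := α.comapDomain (skip k) (skip_injective k).injOn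

/-- Lower the `x`-entry of column `k` by one. -/
def decX (k : ℕ) (α : GBicomp) : GBicomp := α.update k ((α k).1 - 1, (α k).2)

/-- Lower the `y`-entry of column `k` by one. -/
def decY (k : ℕ) (α : GBicomp) : GBicomp := α.update k ((α k).1, (α k).2 - 1)

/-- The position of the last zero column before the last nonzero column, if there is one. -/
def lastZero (α : GBicomp) : ℕ := ((Finset.range (len α)).filter (fun j => α j = 0)).sup id

theorem len_le {α : GBicomp} {n : ℕ} (h : ∀ j, α j ≠ 0 → j < n) : len α ≤ n :=
  Finset.sup_le fun j hj => h j (Finsupp.mem_support_iff.1 hj)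

theorem lastZero_mem {α : GBicomp} (h : ¬ IsBicomp α) :
    lastZero α < len α ∧ α (lastZero α) = 0 := by
  have hne : ((Finset.range (len α)).filter (fun j => α j = 0)).Nonempty := by
    unfold IsBicomp at h
    push Not at h
    obtain ⟨j, hj, h0⟩ := h
    exact ⟨j, by simp [hj, h0]⟩
  obtain ⟨j, hj, hs⟩ := Finset.exists_mem_eq_sup _ hne id
  simp only [Finset.mem_filter, Finset.mem_range, id] at hj hs
  unfold lastZero
  rw [hs]
  exact hj

theorem len_deleteCol {α : GBicomp} {k : ℕ} (h : k < len α) : len (deleteCol k α) < len α := by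
  have : len (deleteCol k α) ≤ len α - 1 := by
    refine len_le fun j hj => ?_
    have := lt_len (α := α) (j := skip k j) (by simpa [deleteCol] using hj)
    unfold skip at this
    split_ifs at this <;> omega
  omega

theorem len_decX_le (k : ℕ) (α : GBicomp) : len (decX k α) ≤ len α := by
  refine len_le fun j hj => lt_len fun h0 => hj ?_
  by_cases hjk : j = k
  · subst hjk
    simp [decX, h0]
  · simp [decX, Function.update_of_ne hjk, h0]

theorem len_decY_le (k : ℕ) (α : GBicomp) : len (decY k α) ≤ len α := by
  refine len_le fun j hj => lt_len fun h0 => hj ?_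
  by_cases hjk : j = k
  · subst hjk
    simp [decY, h0]
  · simp [decY, Function.update_of_ne hjk, h0]

open Classical in
/-- The series `G_ε`. If `ε` is not a bicomposition, it consists of `k` columns, a zero column
and a nonzero bicomposition `β`, where `k = lastZero ε`; `β` starts in column `k + 1` of `ε`
and in column `k` of `deleteCol k ε`. -/
def G (ε : GBicomp) : R :=
  if h : IsBicomp ε then F ε
  else
    have _h1 := len_deleteCol (lastZero_mem h).1
    have _h2 := len_decX_le (lastZero ε) (deleteCol (lastZero ε) ε)
    have _h3 := len_decY_le (lastZero ε) (deleteCol (lastZero ε) ε)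
    if 0 < (ε (lastZero ε + 1)).1 then
      G (deleteCol (lastZero ε) ε)
        - x (lastZero ε) * G (decX (lastZero ε) (deleteCol (lastZero ε) ε))
    else
      G (deleteCol (lastZero ε) ε)
        - y (lastZero ε) * G (decY (lastZero ε) (deleteCol (lastZero ε) ε))
termination_by len ε
decreasing_by all_goals omega

/-- The index of `φ(x_i, G_γ)`: columns `…, (0, 0), (γ₁ᵢ + 1, γ₂ᵢ), …`. -/
def phiX (i : ℕ) (γ : GBicomp) : GBicomp := insertZero i γ + Finsupp.single (i + 1) (1, 0)

/-- The index of `φ(y_i, G_γ)`: columns `…, (0, 0), (0, γ₂ᵢ + 1), …` if `γ₁ᵢ = 0`, and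
`…, (0, 0), (0, 1), (γ₁ᵢ, γ₂ᵢ), …` otherwise. -/
def phiY (i : ℕ) (γ : GBicomp) : GBicomp :=
  if (γ i).1 = 0 then insertZero i γ + Finsupp.single (i + 1) (0, 1)
  else insertZero i (insertZero i γ) + Finsupp.single (i + 1) (0, 1)

/-- `φ` applied along `⋯ (x₁^{α₁₁} (y₁^{α₂₁} (x₀^{α₁₀} (y₀^{α₂₀} F_β))))`, restricted to the
variables with index `< n`. -/
def PhiAux (α β : GBicomp) : ℕ → GBicomp
  | 0 => β
  | n + 1 => (phiX n)^[(α n).1] ((phiY n)^[(α n).2] (PhiAux α β n))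

/-- The index of `Φ(X^α F_β)`. -/
def Phi (α β : GBicomp) : GBicomp := PhiAux α β (len α)

/-- The image of `Φ`, which is defined on all `X^α F_β` with `β` a bicomposition, `|β| ≥ 1`. -/
def imgPhi : Set R := {g | ∃ α β, IsBicomp β ∧ β ≠ 0 ∧ g = G (Phi α β)}

/-- The members of the `G` basis outside of the image of `Φ`. -/
def A : Set R := {g | (∃ α, g = G α) ∧ g ∉ imgPhi}

end DQSym

end

/-!
The classes of the series `G_γ` in `R / I` are classes of polynomials, and these polynomials are
controlled by their leading monomials.

*Reduction.* `F_0 = 1`, and `F_β ∈ I` for all bicompositions `β ≠ 0`. Read backwards, the recursion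
for `G` says `G (phiX i γ) = G (γ + e) - x i * G γ`, where `e` is one `x` in column `i`, and
similarly for `y` (`G_phiX`, `G_phiY₀`); every index that is not a bicomposition is of this form.
So `G_γ` is congruent modulo `I` to a polynomial `ρ γ` that obeys the same rules (`IsReduction`).
The polynomial is unique, because `ℚ[x, y]` injects into `R / I`.

*Injectivity* (`eq_zero_of_mem_I`). Let `ζ` be a primitive root of unity of order `d + 1`. Any
quasi-symmetric `M_α` with `1 ≤ |α| ≤ d` vanishes on the list of points `t, ζt, …, ζᵈt`: rotating
the list multiplies all points by `ζ` but does not change the value (`listEval_orbit`). Nesting such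
orbits (`t₁, t₂, …`, followed at the end by the rest of the orbit of `t₂` and then the rest of
the orbit of `t₁`) gives lists with arbitrary first points on which these `M_α` vanish
(`listEval_nest`). Hence a polynomial of degree `≤ d` in `I` vanishes at all
points. The evaluation is made compatible with power series by a grading variable `T`.

*Leading monomials.* The reduction of the index `Φ(X^α F_0)` is `± X^α` plus smaller monomials for
the following order (`Lower`): compare the last columns that differ, as words `x^a y^b` in the
lexicographic order with `x < y` (`IsReduction.PhiAux_leading`). As this order is well-founded,
these polynomials form a basis of `ℚ[x, y]` (`IsReduction.basis`).

*The set `A`.* On indices, `(α, β) ↦ Φ(X^α F_β)` determines `β` (`Phi_inj`), and each generalized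
bicomposition is reached if `β = 0` is admitted (`exists_Phi_eq`). Moreover `γ ↦ G_γ` is injective,
since the lexicographically largest monomial of `G_γ` is `X^γ` (`leading_G`, `G_injective`).
Therefore `A` consists of the `G_γ` for `γ = Φ(X^α F_0)` (`A_eq_range`), and their classes are
a basis of the image of `ℚ[x, y]` in `R / I`, which is dense.
-/

noncomputable section

namespace DQSym

/-! ### Generalized bicompositions and operations on columns -/

/-- The columns from position `n` on form a bicomposition: after position `n`, a zero column is
followed by zero columns only. -/
def Tail (n : ℕ) (γ : GBicomp) : Prop := ∀ j, n ≤ j → γ j = 0 → γ (j + 1) = 0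

theorem Tail.zero_of_le {n : ℕ} {γ : GBicomp} (h : Tail n γ) {j k : ℕ} (hn : n ≤ j) (hj : γ j = 0)
    (hk : j ≤ k) : γ k = 0 := by
  induction k, hk using Nat.le_induction with
  | base => exact hj
  | succ k hk ih => exact h k (hn.trans hk) ih

theorem Tail.mono {m n : ℕ} {γ : GBicomp} (h : Tail m γ) (hmn : m ≤ n) : Tail n γ :=
  fun j hj => h j (hmn.trans hj)

theorem exists_of_lt_len {γ : GBicomp} {j : ℕ} (h : j < len γ) : ∃ k, j ≤ k ∧ γ k ≠ 0 := by
  by_contra! hc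
  have : len γ ≤ j := len_le fun k hk => by
    by_contra! hjk
    exact hk (hc k hjk)
  omega

theorem eq_zero_of_len_le {γ : GBicomp} {j : ℕ} (h : len γ ≤ j) : γ j = 0 := by
  by_contra hc
  have := lt_len hc
  omega

theorem isBicomp_iff_tail {γ : GBicomp} : IsBicomp γ ↔ Tail 0 γ := by
  constructor
  · intro h j _ hj
    by_contra hc
    exact h j ((Nat.lt_succ_self j).trans (lt_len hc)) hj
  · intro h j hj h0
    obtain ⟨k, hjk, hk⟩ := exists_of_lt_len hj
    exact hk (h.zero_of_le (Nat.zero_le j) h0 hjk)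

theorem exists_tail (γ : GBicomp) : Tail (len γ) γ :=
  fun _ hj _ => eq_zero_of_len_le (hj.trans (Nat.le_succ _))

theorem isBicomp_zero : IsBicomp 0 := isBicomp_iff_tail.2 fun _ _ _ => rfl

/-- `phiY i` on `γ` with no `x` in column `i`; on other `γ`, it is `phiY₀ i` after the insertion of
a zero column at position `i`. -/
def phiY₀ (i : ℕ) (γ : GBicomp) : GBicomp := insertZero i γ + Finsupp.single (i + 1) (0, 1)

theorem insertZero_apply (i : ℕ) (γ : GBicomp) (j : ℕ) :
    insertZero i γ j = if j < i then γ j else if j = i then 0 else γ (j - 1) := by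
  unfold insertZero
  split_ifs with h1 h2
  · have : skip i j = j := by simp [skip, h1]
    conv_lhs => rw [← this]
    exact Finsupp.mapDomain_apply (skip_injective i) γ j
  · refine Finsupp.mapDomain_of_notMem_range γ j ?_
    rintro ⟨k, hk⟩
    unfold skip at hk
    split_ifs at hk <;> omega
  · have : skip i (j - 1) = j := by unfold skip; split_ifs <;> omega
    conv_lhs => rw [← this]
    exact Finsupp.mapDomain_apply (skip_injective i) γ (j - 1)

theorem deleteCol_apply (i : ℕ) (γ : GBicomp) (j : ℕ) :
    deleteCol i γ j = if j < i then γ j else γ (j + 1) := by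
  simp only [deleteCol, Finsupp.comapDomain_apply, skip]
  split_ifs <;> rfl

theorem decX_apply (i : ℕ) (γ : GBicomp) (j : ℕ) :
    decX i γ j = if j = i then ((γ i).1 - 1, (γ i).2) else γ j := by
  simp only [decX, Finsupp.coe_update, Function.update_apply]

theorem decY_apply (i : ℕ) (γ : GBicomp) (j : ℕ) :
    decY i γ j = if j = i then ((γ i).1, (γ i).2 - 1) else γ j := by
  simp only [decY, Finsupp.coe_update, Function.update_apply]

theorem addX_apply (i : ℕ) (γ : GBicomp) (j : ℕ) :
    (γ + Finsupp.single i (1, 0) : GBicomp) j = if j = i then ((γ i).1 + 1, (γ i).2) else γ j := by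
  rw [Finsupp.add_apply, Finsupp.single_apply]
  split_ifs with h1 h2 h2
  · subst h2; rfl
  · exact absurd h1.symm h2
  · exact absurd h2.symm h1
  · simp

theorem addY_apply (i : ℕ) (γ : GBicomp) (j : ℕ) :
    (γ + Finsupp.single i (0, 1) : GBicomp) j = if j = i then ((γ i).1, (γ i).2 + 1) else γ j := by
  rw [Finsupp.add_apply, Finsupp.single_apply]
  split_ifs with h1 h2 h2
  · subst h2; rfl
  · exact absurd h1.symm h2
  · exact absurd h2.symm h1
  · simp

theorem phiX_apply (i : ℕ) (γ : GBicomp) (j : ℕ) :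
    phiX i γ j = if j < i then γ j else if j = i then 0 else
      if j = i + 1 then ((γ i).1 + 1, (γ i).2) else γ (j - 1) := by
  rw [phiX, addX_apply, insertZero_apply, insertZero_apply]
  split_ifs <;> first | rfl | omega

theorem phiY₀_apply (i : ℕ) (γ : GBicomp) (j : ℕ) :
    phiY₀ i γ j = if j < i then γ j else if j = i then 0 else
      if j = i + 1 then ((γ i).1, (γ i).2 + 1) else γ (j - 1) := by
  rw [phiY₀, addY_apply, insertZero_apply, insertZero_apply]
  split_ifs <;> first | rfl | omega

theorem tail_phiX {i : ℕ} {γ : GBicomp} (h : Tail (i + 1) γ) : Tail (i + 1) (phiX i γ) := by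
  intro j hj hz
  rw [phiX_apply] at hz
  rw [phiX_apply]
  rcases hj.eq_or_lt with rfl | hj
  · simp at hz
  · rw [if_neg (by omega), if_neg (by omega), if_neg (by omega)] at hz ⊢
    have := h (j - 1) (by omega) hz
    rwa [Nat.sub_add_cancel (by omega)] at this

theorem tail_phiY₀ {i : ℕ} {γ : GBicomp} (h : Tail (i + 1) γ) : Tail (i + 1) (phiY₀ i γ) := by
  intro j hj hz
  rw [phiY₀_apply] at hz
  rw [phiY₀_apply]
  rcases hj.eq_or_lt with rfl | hj
  · simp at hz
  · rw [if_neg (by omega), if_neg (by omega), if_neg (by omega)] at hz ⊢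
    have := h (j - 1) (by omega) hz
    rwa [Nat.sub_add_cancel (by omega)] at this

theorem phiY_of_eq {i : ℕ} {γ : GBicomp} (h : (γ i).1 = 0) : phiY i γ = phiY₀ i γ := by
  rw [phiY, if_pos h, phiY₀]

theorem phiY_of_ne {i : ℕ} {γ : GBicomp} (h : (γ i).1 ≠ 0) :
    phiY i γ = phiY₀ i (insertZero i γ) := by
  rw [phiY, if_neg h, phiY₀]

theorem size_insertZero (i : ℕ) (γ : GBicomp) : size (insertZero i γ) = size γ := by
  unfold size insertZero
  exact Finsupp.sum_mapDomain_index (fun _ => rfl)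
    (fun _ a b => by simp only [Prod.fst_add, Prod.snd_add]; omega)

theorem size_add (α β : GBicomp) : size (α + β) = size α + size β :=
  Finsupp.sum_add_index' (fun _ => rfl)
    (fun _ a b => by simp only [Prod.fst_add, Prod.snd_add]; omega)

theorem size_single (i : ℕ) (c : ℕ × ℕ) : size (Finsupp.single i c) = c.1 + c.2 :=
  Finsupp.sum_single_index rfl

theorem size_eq_zero {α : GBicomp} (h : size α = 0) : α = 0 := by
  ext1 j
  by_contra hj
  have : (α j).1 + (α j).2 ≤ size α :=
    Finset.single_le_sum (f := fun j => (α j).1 + (α j).2) (fun _ _ => Nat.zero_le _)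
      (Finsupp.mem_support_iff.2 hj)
  exact hj (Prod.ext (by simp only [Finsupp.coe_zero, Pi.zero_apply, Prod.fst_zero]; omega)
    (by simp only [Finsupp.coe_zero, Pi.zero_apply, Prod.snd_zero]; omega))

/-! ### The recursion for `G` -/

/-- A zero column `i` followed by a nonzero bicomposition is the last zero column. -/
theorem lastZero_eq {ε : GBicomp} {i : ℕ} (h0 : ε i = 0) (h1 : ε (i + 1) ≠ 0)
    (ht : Tail (i + 1) ε) : ¬ IsBicomp ε ∧ lastZero ε = i := by
  have hlen : i < len ε := (Nat.lt_succ_self i).trans (lt_len h1)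
  have hn : ¬ IsBicomp ε := fun h => h i hlen h0
  refine ⟨hn, le_antisymm ?_ ?_⟩
  · obtain ⟨hl, hz⟩ := lastZero_mem hn
    by_contra! hc
    obtain ⟨k, hk, hk'⟩ := exists_of_lt_len hl
    exact hk' (ht.zero_of_le hc hz hk)
  · exact Finset.le_sup (f := id) (by simp [hlen, h0])

theorem G_of_isBicomp {β : GBicomp} (h : IsBicomp β) : G β = F β := by
  rw [G, dif_pos h]

/-- The recursion for `G`, read as multiplication of `G_γ` by `x_i`. -/
theorem G_phiX {i : ℕ} {γ : GBicomp} (h : Tail (i + 1) γ) :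
    G (phiX i γ) = G (γ + Finsupp.single i (1, 0)) - x i * G γ := by
  have h0 : phiX i γ i = 0 := by simp [phiX_apply]
  have h1 : phiX i γ (i + 1) = ((γ i).1 + 1, (γ i).2) := by simp [phiX_apply]
  obtain ⟨hb, hl⟩ := lastZero_eq h0 (by rw [h1]; simp [Prod.ext_iff]) (tail_phiX h)
  have hd : deleteCol i (phiX i γ) = γ + Finsupp.single i (1, 0) := by
    ext1 j
    rw [deleteCol_apply, phiX_apply, phiX_apply, addX_apply]
    split_ifs <;> first | rfl | omega
  have hx : decX i (γ + Finsupp.single i (1, 0)) = γ := by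
    ext1 j
    rw [decX_apply, addX_apply, addX_apply, if_pos (rfl : i = i)]
    split_ifs with hj
    · subst hj; rfl
    · rfl
  rw [G, dif_neg hb]
  simp only [hl, h1, hd, hx]
  rw [if_pos (Nat.succ_pos _)]

/-- The recursion for `G`, read as multiplication of `G_γ` by `y_i`. -/
theorem G_phiY₀ {i : ℕ} {γ : GBicomp} (h : Tail (i + 1) γ) (ha : (γ i).1 = 0) :
    G (phiY₀ i γ) = G (γ + Finsupp.single i (0, 1)) - y i * G γ := by
  have h0 : phiY₀ i γ i = 0 := by simp [phiY₀_apply]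
  have h1 : phiY₀ i γ (i + 1) = ((γ i).1, (γ i).2 + 1) := by simp [phiY₀_apply]
  obtain ⟨hb, hl⟩ := lastZero_eq h0 (by rw [h1]; simp [Prod.ext_iff]) (tail_phiY₀ h)
  have hd : deleteCol i (phiY₀ i γ) = γ + Finsupp.single i (0, 1) := by
    ext1 j
    rw [deleteCol_apply, phiY₀_apply, phiY₀_apply, addY_apply]
    split_ifs <;> first | rfl | omega
  have hx : decY i (γ + Finsupp.single i (0, 1)) = γ := by
    ext1 j
    rw [decY_apply, addY_apply, addY_apply, if_pos (rfl : i = i)]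
    split_ifs with hj
    · subst hj; rfl
    · rfl
  rw [G, dif_neg hb]
  simp only [hl, h1, hd, hx]
  rw [if_neg (by omega)]

/-- Every generalized bicomposition that is not a bicomposition arises from shorter ones as in
`G_phiX` or in `G_phiY₀`. -/
theorem exists_phi_of_not_isBicomp {ε : GBicomp} (h : ¬ IsBicomp ε) :
    ∃ i γ, Tail (i + 1) γ ∧ len γ < len ε ∧
      ((ε = phiX i γ ∧ len (γ + Finsupp.single i (1, 0)) < len ε) ∨
        ((γ i).1 = 0 ∧ ε = phiY₀ i γ ∧ len (γ + Finsupp.single i (0, 1)) < len ε)) := by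
  obtain ⟨hl, h0⟩ := lastZero_mem h
  set i := lastZero ε with hi
  have ht : ∀ j, i < j → ε j = 0 → len ε ≤ j := by
    intro j hj hz
    by_contra! hc
    have : j ≤ lastZero ε := Finset.le_sup (f := id) (by simp [hc, hz])
    omega
  have h1 : ε (i + 1) ≠ 0 := by
    intro hz
    have h2 := ht _ (Nat.lt_succ_self i) hz
    obtain ⟨k, hk, hk'⟩ := exists_of_lt_len hl
    have := lt_len hk'
    have : k = i := by omega
    exact hk' (this ▸ h0)
  have hdl := len_deleteCol hl
  have htail : ∀ j, i < j → deleteCol i ε j = 0 → deleteCol i ε (j + 1) = 0 := by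
    intro j hj hz
    rw [deleteCol_apply, if_neg (by omega)] at hz ⊢
    exact eq_zero_of_len_le ((ht _ (by omega) hz).trans (Nat.le_succ _))
  by_cases hx : (ε (i + 1)).1 = 0
  · have hy : (ε (i + 1)).2 ≠ 0 := fun hy => h1 (Prod.ext hx hy)
    refine ⟨i, decY i (deleteCol i ε), ?_, (len_decY_le _ _).trans_lt hdl, Or.inr ⟨?_, ?_, ?_⟩⟩
    · intro j hj hz
      rw [decY_apply, if_neg (by omega)] at hz ⊢
      exact htail j hj hz
    · simp [decY_apply, deleteCol_apply, hx]
    · ext1 j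
      rw [phiY₀_apply, decY_apply, decY_apply, decY_apply, deleteCol_apply, deleteCol_apply,
        deleteCol_apply]
      split_ifs with a b c d e f
      all_goals first | rfl | omega | skip
      · rw [d, h0]
      · rw [e]
        exact Prod.ext rfl (by simp only; omega)
      · congr 1; omega
    · have : decY i (deleteCol i ε) + Finsupp.single i (0, 1) = deleteCol i ε := by
        ext1 j
        rw [addY_apply, decY_apply, decY_apply, if_pos (rfl : i = i)]
        split_ifs with hj
        · subst hj
          rw [deleteCol_apply, if_neg (by omega)]
          exact Prod.ext rfl (by simp only; omega)
        · rfl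
      rwa [this]
  · refine ⟨i, decX i (deleteCol i ε), ?_, (len_decX_le _ _).trans_lt hdl, Or.inl ⟨?_, ?_⟩⟩
    · intro j hj hz
      rw [decX_apply, if_neg (by omega)] at hz ⊢
      exact htail j hj hz
    · ext1 j
      rw [phiX_apply, decX_apply, decX_apply, decX_apply, deleteCol_apply, deleteCol_apply,
        deleteCol_apply]
      split_ifs with a b c d e f
      all_goals first | rfl | omega | skip
      · rw [d, h0]
      · rw [e]
        exact Prod.ext (by simp only; omega) rfl
      · congr 1; omega
    · have : decX i (deleteCol i ε) + Finsupp.single i (1, 0) = deleteCol i ε := by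
        ext1 j
        rw [addX_apply, decX_apply, decX_apply, if_pos (rfl : i = i)]
        split_ifs with hj
        · subst hj
          rw [deleteCol_apply, if_neg (by omega)]
          exact Prod.ext (by simp only; omega) rfl
        · rfl
      rwa [this]

/-- Induction along the recursion that defines `G`. -/
theorem G_induction {P : GBicomp → Prop} (hb : ∀ β, IsBicomp β → P β)
    (hX : ∀ i γ, Tail (i + 1) γ → P γ → P (γ + Finsupp.single i (1, 0)) → P (phiX i γ))
    (hY : ∀ i γ, Tail (i + 1) γ → (γ i).1 = 0 → P γ → P (γ + Finsupp.single i (0, 1)) →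
      P (phiY₀ i γ)) (ε : GBicomp) : P ε := by
  induction hn : len ε using Nat.strong_induction_on generalizing ε with
  | _ n ih =>
    by_cases h : IsBicomp ε
    · exact hb ε h
    · subst hn
      obtain ⟨i, γ, ht, hl, ⟨rfl, hl'⟩ | ⟨ha, rfl, hl'⟩⟩ := exists_phi_of_not_isBicomp h
      · exact hX i γ ht (ih _ hl γ rfl) (ih _ hl' _ rfl)
      · exact hY i γ ht ha (ih _ hl γ rfl) (ih _ hl' _ rfl)

/-! ### The map `Φ` on indices -/

/-- The passage from variables with index `< n` to those with index `≤ n` in `PhiAux`. -/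
def stage (n : ℕ) (c : ℕ × ℕ) (γ : GBicomp) : GBicomp := (phiX n)^[c.1] ((phiY n)^[c.2] γ)

theorem PhiAux_succ (α β : GBicomp) (n : ℕ) :
    PhiAux α β (n + 1) = stage n (α n) (PhiAux α β n) := rfl

theorem tail_insertZero {n : ℕ} {γ : GBicomp} (h : Tail (n + 1) γ) (h0 : γ n ≠ 0) :
    Tail (n + 1) (insertZero n γ) := by
  intro j hj hz
  rw [insertZero_apply, if_neg (by omega), if_neg (by omega)] at hz ⊢
  rcases hj.eq_or_lt with rfl | hj
  · exact absurd hz h0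
  · have := h (j - 1) (by omega) hz
    rwa [Nat.sub_add_cancel (by omega)] at this

theorem tail_phiY {n : ℕ} {γ : GBicomp} (h : Tail (n + 1) γ) : Tail (n + 1) (phiY n γ) := by
  by_cases ha : (γ n).1 = 0
  · rw [phiY_of_eq ha]
    exact tail_phiY₀ h
  · rw [phiY_of_ne ha]
    exact tail_phiY₀ (tail_insertZero h fun h0 => ha (by rw [h0]; rfl))

theorem tail_phiY_iterate {n : ℕ} {γ : GBicomp} (h : Tail (n + 1) γ) (b : ℕ) :
    Tail (n + 1) ((phiY n)^[b] γ) := by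
  induction b with
  | zero => exact h
  | succ b ih => rw [Function.iterate_succ_apply']; exact tail_phiY ih

theorem tail_stage {n : ℕ} {γ : GBicomp} (h : Tail (n + 1) γ) (c : ℕ × ℕ) :
    Tail (n + 1) (stage n c γ) := by
  obtain ⟨a, b⟩ := c
  unfold stage
  induction a with
  | zero => exact tail_phiY_iterate h b
  | succ a ih => simp only [Function.iterate_succ_apply']; exact tail_phiX ih

theorem tail_PhiAux {β : GBicomp} (hβ : IsBicomp β) (α : GBicomp) (n : ℕ) :
    Tail n (PhiAux α β n) := by
  induction n with
  | zero => exact isBicomp_iff_tail.1 hβ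
  | succ n ih => exact tail_stage (ih.mono (Nat.le_succ n)) _

theorem PhiAux_congr {α α' : GBicomp} (β : GBicomp) {n : ℕ} (h : ∀ j < n, α j = α' j) :
    PhiAux α β n = PhiAux α' β n := by
  induction n with
  | zero => rfl
  | succ n ih =>
    rw [PhiAux_succ, PhiAux_succ, ih fun j hj => h j (hj.trans (Nat.lt_succ_self n)),
      h n (Nat.lt_succ_self n)]

theorem Phi_eq_PhiAux {α : GBicomp} (β : GBicomp) {n : ℕ} (h : len α ≤ n) :
    Phi α β = PhiAux α β n := by
  induction n, h using Nat.le_induction with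
  | base => rfl
  | succ n hn ih => rw [PhiAux_succ, eq_zero_of_len_le hn, ← ih]; rfl

/-- In the image of `phiY n`, the column after the zero column `n` has no `x`; the same holds
for bicompositions from column `n` on. In the image of `phiX n` it fails. -/
def YFirst (n : ℕ) (γ : GBicomp) : Prop := γ n = 0 → (γ (n + 1)).1 = 0

theorem Tail.yFirst {n : ℕ} {γ : GBicomp} (h : Tail n γ) : YFirst n γ :=
  fun h0 => by rw [h n le_rfl h0]; rfl

theorem insertZero_cols (n : ℕ) (γ : GBicomp) :
    insertZero n γ n = 0 ∧ insertZero n γ (n + 1) = γ n := by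
  constructor <;> simp [insertZero_apply]

theorem phiX_cols (n : ℕ) (γ : GBicomp) :
    phiX n γ n = 0 ∧ phiX n γ (n + 1) = ((γ n).1 + 1, (γ n).2) := by
  constructor <;> simp [phiX_apply]

theorem phiY_cols (n : ℕ) (γ : GBicomp) :
    phiY n γ n = 0 ∧ (phiY n γ (n + 1)).1 = 0 ∧ (phiY n γ (n + 1)).2 ≠ 0 := by
  by_cases ha : (γ n).1 = 0
  · rw [phiY_of_eq ha]
    simp [phiY₀_apply, ha]
  · rw [phiY_of_ne ha]
    simp [phiY₀_apply, insertZero_apply]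

theorem yFirst_phiY_iterate {n : ℕ} {γ : GBicomp} (h : Tail n γ) (b : ℕ) :
    YFirst n ((phiY n)^[b] γ) := by
  cases b with
  | zero => exact h.yFirst
  | succ b => rw [Function.iterate_succ_apply']; exact fun _ => (phiY_cols n _).2.1

theorem insertZero_injective (n : ℕ) : Function.Injective (insertZero n) :=
  Finsupp.mapDomain_injective (skip_injective n)

theorem phiX_injective (n : ℕ) : Function.Injective (phiX n) := fun _ _ h =>
  insertZero_injective n (add_right_cancel h)

theorem phiY₀_injective (n : ℕ) : Function.Injective (phiY₀ n) := fun _ _ h =>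
  insertZero_injective n (add_right_cancel h)

theorem phiY_inj {n : ℕ} {γ δ : GBicomp} (hγ : YFirst n γ) (hδ : YFirst n δ)
    (h : phiY n γ = phiY n δ) : γ = δ := by
  have key : ∀ {γ δ : GBicomp}, YFirst n γ → (δ n).1 ≠ 0 → γ ≠ insertZero n δ := by
    rintro γ δ hγ hb rfl
    obtain ⟨h0, h1⟩ := insertZero_cols n δ
    exact hb (by rw [← h1]; exact hγ h0)
  by_cases ha : (γ n).1 = 0 <;> by_cases hb : (δ n).1 = 0
  · rw [phiY_of_eq ha, phiY_of_eq hb] at h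
    exact phiY₀_injective n h
  · rw [phiY_of_eq ha, phiY_of_ne hb] at h
    exact absurd (phiY₀_injective n h) (key hγ hb)
  · rw [phiY_of_ne ha, phiY_of_eq hb] at h
    exact absurd (phiY₀_injective n h).symm (key hδ ha)
  · rw [phiY_of_ne ha, phiY_of_ne hb] at h
    exact insertZero_injective n (phiY₀_injective n h)

theorem phiY_iterate_inj {n : ℕ} {γ δ : GBicomp} (hγ : Tail n γ) (hδ : Tail n δ) {b b' : ℕ}
    (h : (phiY n)^[b] γ = (phiY n)^[b'] δ) : b = b' ∧ γ = δ := by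
  have key : ∀ {γ δ : GBicomp}, Tail n γ → γ ≠ phiY n δ := by
    rintro γ δ hγ rfl
    obtain ⟨h0, -, h2⟩ := phiY_cols n δ
    exact h2 (by rw [hγ n le_rfl h0]; rfl)
  induction b generalizing b' with
  | zero =>
    cases b' with
    | zero => exact ⟨rfl, h⟩
    | succ b' =>
      rw [Function.iterate_succ_apply'] at h
      exact absurd h (key hγ)
  | succ b ih =>
    rw [Function.iterate_succ_apply'] at h
    cases b' with
    | zero => exact absurd h.symm (key hδ)
    | succ b' =>
      rw [Function.iterate_succ_apply'] at h
      obtain ⟨rfl, h2⟩ := ih (phiY_inj (yFirst_phiY_iterate hγ b) (yFirst_phiY_iterate hδ b') h)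
      exact ⟨rfl, h2⟩

theorem stage_inj {n : ℕ} {γ δ : GBicomp} (hγ : Tail n γ) (hδ : Tail n δ) {c c' : ℕ × ℕ}
    (h : stage n c γ = stage n c' δ) : c = c' ∧ γ = δ := by
  obtain ⟨a, b⟩ := c
  obtain ⟨a', b'⟩ := c'
  simp only [stage] at h
  have key : ∀ {γ δ : GBicomp}, YFirst n γ → γ ≠ phiX n δ := by
    rintro γ δ hγ rfl
    obtain ⟨h0, h1⟩ := phiX_cols n δ
    have := hγ h0
    rw [h1] at this
    exact Nat.succ_ne_zero _ this
  induction a generalizing a' with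
  | zero =>
    cases a' with
    | zero =>
      obtain ⟨rfl, h2⟩ := phiY_iterate_inj hγ hδ h
      exact ⟨rfl, h2⟩
    | succ a' =>
      rw [Function.iterate_succ_apply'] at h
      exact absurd h (key (yFirst_phiY_iterate hγ b))
  | succ a ih =>
    rw [Function.iterate_succ_apply'] at h
    cases a' with
    | zero => exact absurd h.symm (key (yFirst_phiY_iterate hδ b'))
    | succ a' =>
      rw [Function.iterate_succ_apply'] at h
      obtain ⟨h1, h2⟩ := ih a' (phiX_injective n h)
      rw [Prod.mk.injEq] at h1
      obtain ⟨rfl, rfl⟩ := h1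
      exact ⟨rfl, h2⟩

theorem PhiAux_inj {α α' β β' : GBicomp} (hβ : IsBicomp β) (hβ' : IsBicomp β') {n : ℕ}
    (h : PhiAux α β n = PhiAux α' β' n) : β = β' := by
  induction n with
  | zero => exact h
  | succ n ih => exact ih (stage_inj (tail_PhiAux hβ α n) (tail_PhiAux hβ' α' n) h).2

/-- The index `Φ(X^α F_β)` determines `β`. -/
theorem Phi_inj {α α' β β' : GBicomp} (hβ : IsBicomp β) (hβ' : IsBicomp β')
    (h : Phi α β = Phi α' β') : β = β' := by
  rw [Phi_eq_PhiAux β (le_max_left (len α) (len α')),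
    Phi_eq_PhiAux β' (le_max_right (len α) (len α'))] at h
  exact PhiAux_inj hβ hβ' h

/-- A zero column `n` followed by a nonzero bicomposition can be removed: the first column behind
it was last changed by `phiX n` if it contains `x`, and by `phiY n` otherwise. -/
theorem exists_stage_eq {n : ℕ} {γ : GBicomp} (h : Tail (n + 1) γ) :
    ∃ c δ, Tail n δ ∧ stage n c δ = γ := by
  induction hs : size γ using Nat.strong_induction_on generalizing γ with
  | _ s ih =>
  subst hs
  by_cases hn : Tail n γ
  · exact ⟨0, γ, hn, rfl⟩
  obtain ⟨h0, h1⟩ : γ n = 0 ∧ γ (n + 1) ≠ 0 := by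
    by_contra hc
    refine hn fun j hj hz => ?_
    rcases hj.eq_or_lt with rfl | hj
    · by_contra h1
      exact hc ⟨hz, h1⟩
    · exact h j hj hz
  have htail : ∀ j, n < j → deleteCol n γ j = 0 → deleteCol n γ (j + 1) = 0 := by
    intro j hj hz
    rw [deleteCol_apply, if_neg (by omega)] at hz ⊢
    exact h _ (by omega) hz
  by_cases hx : (γ (n + 1)).1 = 0
  · have hy : (γ (n + 1)).2 ≠ 0 := fun hy => h1 (Prod.ext hx hy)
    set u := decY n (deleteCol n γ) with hu
    have hγ : phiY₀ n u = γ := by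
      ext1 j
      rw [phiY₀_apply, hu, decY_apply, decY_apply, decY_apply, deleteCol_apply, deleteCol_apply,
        deleteCol_apply]
      split_ifs with a b c d e f
      all_goals first | rfl | omega | skip
      · rw [d, h0]
      · rw [e]
        exact Prod.ext rfl (by simp only; omega)
      · congr 1; omega
    have hux : (u n).1 = 0 := by simp [hu, decY_apply, deleteCol_apply, hx]
    have hut : Tail (n + 1) u := by
      intro j hj hz
      rw [hu, decY_apply, if_neg (by omega)] at hz ⊢
      exact htail j hj hz
    have hsz : size u < size γ := by
      rw [← hγ, phiY₀, size_add, size_insertZero, size_single]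
      omega
    obtain ⟨c, δ, hδ, hc⟩ := ih _ hsz hut rfl
    by_cases hc1 : c.1 = 0
    · refine ⟨(0, c.2 + 1), δ, hδ, ?_⟩
      rw [stage, hc1] at hc
      rw [stage, Function.iterate_succ_apply']
      simp only [Function.iterate_zero, id] at hc ⊢
      rw [hc, phiY_of_eq hux, hγ]
    · -- the first column behind the zero column of `u` contains `x`: the `y` was a new column
      obtain ⟨a, ha⟩ := Nat.exists_eq_succ_of_ne_zero hc1
      rw [stage, ha, Function.iterate_succ_apply'] at hc
      obtain ⟨hu0, hu1⟩ := phiX_cols n ((phiX n)^[a] ((phiY n)^[c.2] δ))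
      rw [hc] at hu0 hu1
      have hw : insertZero n (deleteCol n u) = u := by
        ext1 j
        rw [insertZero_apply, deleteCol_apply, deleteCol_apply]
        split_ifs with a b
        all_goals first | rfl | omega | skip
        · rw [b, hu0]
        · congr 1; omega
      refine ⟨(0, 1), deleteCol n u, ?_, ?_⟩
      · intro j hj hz
        rw [deleteCol_apply, if_neg (by omega)] at hz ⊢
        exact hut _ (by omega) hz
      · simp only [stage, Function.iterate_zero, Function.iterate_one, id]
        rw [phiY_of_ne, hw, hγ]
        rw [deleteCol_apply, if_neg (lt_irrefl n), hu1]
        exact Nat.succ_ne_zero _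
  · set u := decX n (deleteCol n γ) with hu
    have hγ : phiX n u = γ := by
      ext1 j
      rw [phiX_apply, hu, decX_apply, decX_apply, decX_apply, deleteCol_apply, deleteCol_apply,
        deleteCol_apply]
      split_ifs with a b c d e f
      all_goals first | rfl | omega | skip
      · rw [d, h0]
      · rw [e]
        exact Prod.ext (by simp only; omega) rfl
      · congr 1; omega
    have hut : Tail (n + 1) u := by
      intro j hj hz
      rw [hu, decX_apply, if_neg (by omega)] at hz ⊢
      exact htail j hj hz
    have hsz : size u < size γ := by
      rw [← hγ, phiX, size_add, size_insertZero, size_single]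
      omega
    obtain ⟨c, δ, hδ, hc⟩ := ih _ hsz hut rfl
    refine ⟨(c.1 + 1, c.2), δ, hδ, ?_⟩
    rw [stage, Function.iterate_succ_apply']
    rw [stage] at hc
    rw [hc, hγ]

theorem exists_PhiAux_eq (n : ℕ) {γ : GBicomp} (h : Tail n γ) :
    ∃ α β, IsBicomp β ∧ len α ≤ n ∧ PhiAux α β n = γ := by
  induction n generalizing γ with
  | zero => exact ⟨0, γ, isBicomp_iff_tail.2 h, by simp [len], rfl⟩
  | succ n ih =>
    obtain ⟨c, δ, hδ, rfl⟩ := exists_stage_eq h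
    obtain ⟨α, β, hβ, hα, rfl⟩ := ih hδ
    have hupd : ∀ j, (α.update n c) j = if j = n then c else α j := fun j => by
      simp only [Finsupp.coe_update, Function.update_apply]
    refine ⟨α.update n c, β, hβ, len_le fun j hj => ?_, ?_⟩
    · rw [hupd] at hj
      split_ifs at hj with hjn
      · omega
      · have := lt_len hj
        omega
    · rw [PhiAux_succ, hupd, if_pos rfl,
        PhiAux_congr β (α' := α) fun j hj => by rw [hupd, if_neg hj.ne]]

/-- Every generalized bicomposition is an index `Φ(X^α F_β)`, if `β = 0` is admitted. -/
theorem exists_Phi_eq (γ : GBicomp) : ∃ α β, IsBicomp β ∧ Phi α β = γ := by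
  obtain ⟨α, β, hβ, hα, h⟩ := exists_PhiAux_eq (len γ) (exists_tail γ)
  exact ⟨α, β, hβ, by rw [Phi_eq_PhiAux β hα, h]⟩

/-! ### Spaces of polynomials spanned by monomials -/

theorem expo_add (α β : GBicomp) : expo (α + β) = expo α + expo β :=
  Finsupp.sum_add_index' (fun _ => by simp)
    (fun _ _ _ => by simp only [Prod.fst_add, Prod.snd_add, Finsupp.single_add]; abel)

theorem expo_single (i : ℕ) (c : ℕ × ℕ) :
    expo (Finsupp.single i c) = Finsupp.single (Sum.inl i) c.1 + Finsupp.single (Sum.inr i) c.2 :=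
  Finsupp.sum_single_index (by simp)

theorem expo_inl (α : GBicomp) (j : ℕ) : expo α (Sum.inl j) = (α j).1 := by
  induction α using Finsupp.induction_linear with
  | zero => rfl
  | add f g hf hg => simp only [expo_add, Finsupp.add_apply, hf, hg, Prod.fst_add]
  | single i c =>
    rw [expo_single, Finsupp.add_apply, Finsupp.single_apply, Finsupp.single_apply,
      Finsupp.single_apply]
    by_cases h : i = j <;> simp [h]

theorem expo_inr (α : GBicomp) (j : ℕ) : expo α (Sum.inr j) = (α j).2 := by
  induction α using Finsupp.induction_linear with
  | zero => rfl
  | add f g hf hg => simp only [expo_add, Finsupp.add_apply, hf, hg, Prod.snd_add]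
  | single i c =>
    rw [expo_single, Finsupp.add_apply, Finsupp.single_apply, Finsupp.single_apply,
      Finsupp.single_apply]
    by_cases h : i = j <;> simp [h]

theorem expo_injective : Function.Injective expo := fun α β h => by
  ext1 j
  exact Prod.ext (by rw [← expo_inl, h, expo_inl]) (by rw [← expo_inr, h, expo_inr])

theorem expo_surjective : Function.Surjective expo := by
  intro m
  induction m using Finsupp.induction_linear with
  | zero => exact ⟨0, rfl⟩
  | add f g hf hg =>
    obtain ⟨α, rfl⟩ := hf
    obtain ⟨β, rfl⟩ := hg
    exact ⟨α + β, expo_add α β⟩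
  | single i n =>
    rcases i with i | i
    · exact ⟨Finsupp.single i (n, 0), by simp [expo_single]⟩
    · exact ⟨Finsupp.single i (0, n), by simp [expo_single]⟩

/-- The polynomial ring `ℚ[x, y]`. -/
abbrev Poly : Type := MvPolynomial (ℕ ⊕ ℕ) ℚ

/-- The monomial `X^δ`. -/
def mono (δ : GBicomp) : Poly := MvPolynomial.monomial (expo δ) 1

/-- The span of the monomials `X^δ`, `δ ∈ S`. -/
def monoSpan (S : Set GBicomp) : Submodule ℚ Poly := Submodule.span ℚ (mono '' S)

theorem mono_zero : mono 0 = 1 := rfl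

theorem mono_mul (α β : GBicomp) : mono α * mono β = mono (α + β) := by
  rw [mono, mono, mono, MvPolynomial.monomial_mul, one_mul, expo_add]

theorem mono_single_X (i : ℕ) : mono (Finsupp.single i (1, 0)) = MvPolynomial.X (Sum.inl i) := by
  simp [mono, expo_single, MvPolynomial.X]

theorem mono_single_Y (i : ℕ) : mono (Finsupp.single i (0, 1)) = MvPolynomial.X (Sum.inr i) := by
  simp [mono, expo_single, MvPolynomial.X]

theorem mono_mem {S : Set GBicomp} {δ : GBicomp} (h : δ ∈ S) : mono δ ∈ monoSpan S :=
  Submodule.subset_span ⟨δ, h, rfl⟩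

theorem monoSpan_mono {S T : Set GBicomp} (h : S ⊆ T) : monoSpan S ≤ monoSpan T :=
  Submodule.span_mono (Set.image_mono h)

theorem mono_mul_mem {S T : Set GBicomp} {ε : GBicomp} (h : ∀ δ ∈ S, ε + δ ∈ T) {p : Poly}
    (hp : p ∈ monoSpan S) : mono ε * p ∈ monoSpan T := by
  induction hp using Submodule.span_induction with
  | mem p hp =>
    obtain ⟨δ, hδ, rfl⟩ := hp
    rw [mono_mul]
    exact mono_mem (h δ hδ)
  | zero => rw [mul_zero]; exact Submodule.zero_mem _
  | add p q _ _ hp hq => rw [mul_add]; exact Submodule.add_mem _ hp hq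
  | smul c p _ hp => rw [mul_smul_comm]; exact Submodule.smul_mem _ c hp

theorem coeff_expo_mono (α δ : GBicomp) :
    MvPolynomial.coeff (expo α) (mono δ) = if δ = α then 1 else 0 := by
  rw [mono, MvPolynomial.coeff_monomial]
  simp only [expo_injective.eq_iff]

theorem coeff_eq_zero {S : Set GBicomp} {p : Poly} (hp : p ∈ monoSpan S) {α : GBicomp}
    (hα : α ∉ S) : MvPolynomial.coeff (expo α) p = 0 := by
  induction hp using Submodule.span_induction with
  | mem p hp =>
    obtain ⟨δ, hδ, rfl⟩ := hp
    rw [coeff_expo_mono, if_neg]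
    rintro rfl
    exact hα hδ
  | zero => rfl
  | add p q _ _ hp hq => rw [MvPolynomial.coeff_add, hp, hq, add_zero]
  | smul c p _ hp => rw [MvPolynomial.coeff_smul, hp, smul_zero]

theorem mem_monoSpan_univ (p : Poly) : p ∈ monoSpan Set.univ := by
  induction p using MvPolynomial.induction_on' with
  | monomial m c =>
    obtain ⟨δ, rfl⟩ := expo_surjective m
    have : MvPolynomial.monomial (expo δ) c = c • mono δ := by
      rw [mono, MvPolynomial.smul_monomial, smul_eq_mul, mul_one]
    rw [this]
    exact Submodule.smul_mem _ _ (mono_mem (Set.mem_univ δ))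
  | add p q hp hq => exact Submodule.add_mem _ hp hq

/-! ### The order on monomials -/

/-- The lexicographic order on the words `x^a y^b`, where `x < y` and a proper prefix of a word
is smaller than the word; the column `(a, b)` stands for this word. -/
def ColLT (c d : ℕ × ℕ) : Prop :=
  (c.1 = d.1 ∧ c.2 < d.2) ∨ (c.1 < d.1 ∧ c.2 = 0) ∨ (d.1 < c.1 ∧ 0 < d.2)

theorem ColLT.irrefl (c : ℕ × ℕ) : ¬ ColLT c c := by unfold ColLT; omega

theorem ColLT.trans {c d e : ℕ × ℕ} (h : ColLT c d) (h' : ColLT d e) : ColLT c e := by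
  unfold ColLT at *; omega

theorem ColLT.ne_zero {c d : ℕ × ℕ} (h : ColLT c d) : d ≠ 0 := by
  rintro rfl
  simp [ColLT] at h

/-- The order on monomials of the same degree: compare the last columns that differ. -/
def Lower (δ α : GBicomp) : Prop :=
  (∃ k, ColLT (δ k) (α k) ∧ ∀ j, k < j → δ j = α j) ∧ size δ = size α

theorem Lower.irrefl (α : GBicomp) : ¬ Lower α α := fun ⟨⟨_, h, _⟩, _⟩ => ColLT.irrefl _ h

theorem Lower.trans {α β γ : GBicomp} (h : Lower α β) (h' : Lower β γ) : Lower α γ := by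
  obtain ⟨⟨k, hk, h1⟩, hs⟩ := h
  obtain ⟨⟨l, hl, h2⟩, hs'⟩ := h'
  refine ⟨?_, hs.trans hs'⟩
  rcases lt_trichotomy k l with hkl | rfl | hkl
  · exact ⟨l, by rwa [h1 l hkl], fun j hj => (h1 j (hkl.trans hj)).trans (h2 j hj)⟩
  · exact ⟨k, hk.trans hl, fun j hj => (h1 j hj).trans (h2 j hj)⟩
  · exact ⟨k, by rwa [← h2 k hkl], fun j hj => (h1 j hj).trans (h2 j (hkl.trans hj))⟩

theorem Lower.len_le {δ α : GBicomp} (h : Lower δ α) : len δ ≤ len α := by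
  obtain ⟨⟨k, hk, h1⟩, -⟩ := h
  have hlt := lt_len hk.ne_zero
  refine DQSym.len_le fun j hj => ?_
  by_cases hkj : k < j
  · rw [h1 j hkj] at hj
    exact lt_len hj
  · omega

theorem finite_len_size (n d : ℕ) : {δ : GBicomp | len δ ≤ n ∧ size δ = d}.Finite := by
  refine (Finset.finite_toSet ((Finset.range n).finsupp
    fun _ => Finset.range (d + 1) ×ˢ Finset.range (d + 1))).subset ?_
  rintro α ⟨hl, rfl⟩
  refine Finset.mem_coe.2 (Finset.mem_finsupp_iff.2 ⟨fun j hj => Finset.mem_range.2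
    ((lt_len (Finsupp.mem_support_iff.1 hj)).trans_le hl), fun j _ => ?_⟩)
  have : (α j).1 + (α j).2 ≤ size α := by
    by_cases h : α j = 0
    · simp [h]
    · exact Finset.single_le_sum (f := fun j => (α j).1 + (α j).2) (fun _ _ => Nat.zero_le _)
        (Finsupp.mem_support_iff.2 h)
  simp only [Finset.mem_product, Finset.mem_range]
  omega

theorem wellFounded_lower : WellFounded Lower := by
  refine ⟨fun α => ?_⟩
  have hfin := finite_len_size (len α) (size α)
  have hwf : {δ : GBicomp | len δ ≤ len α ∧ size δ = size α}.WellFoundedOn Lower := by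
    have : IsStrictOrder GBicomp Lower :=
      { irrefl := Lower.irrefl, trans := fun _ _ _ h h' => h.trans h' }
    exact hfin.wellFoundedOn
  rw [Set.wellFoundedOn_iff] at hwf
  have key : ∀ δ, len δ ≤ len α → size δ = size α → Acc Lower δ := by
    intro δ
    induction δ using hwf.induction with
    | _ δ ih =>
      intro h1 h2
      refine ⟨_, fun ε hε => ih ε ⟨hε, ⟨hε.len_le.trans h1, hε.2.trans h2⟩, h1, h2⟩
        (hε.len_le.trans h1) (hε.2.trans h2)⟩
  exact key α le_rfl rfl

/-- A family of polynomials whose leading terms are nonzero multiples of the `X^α` is a basis. -/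
theorem basis_of_leading {p : GBicomp → Poly} {u : GBicomp → ℚ} (hu : ∀ α, u α ≠ 0)
    (hp : ∀ α, p α - u α • mono α ∈ monoSpan {δ | Lower δ α}) :
    LinearIndependent ℚ p ∧ Submodule.span ℚ (Set.range p) = ⊤ := by
  constructor
  · rw [linearIndependent_iff]
    intro l hl
    by_contra hne
    obtain ⟨α, hα, hmax⟩ : ∃ α ∈ l.support, ∀ β ∈ l.support, ¬ Lower α β := by
      have : IsStrictOrder GBicomp (Function.swap Lower) :=
        { irrefl := Lower.irrefl, trans := fun _ _ _ h h' => h'.trans h }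
      have hwf := l.support.finite_toSet.wellFoundedOn (r := Function.swap Lower)
      have hne' : (l.support : Set GBicomp).Nonempty :=
        Finset.coe_nonempty.2 (Finsupp.support_nonempty_iff.2 hne)
      obtain ⟨β₀, hβ₀⟩ := hne'
      obtain ⟨α, -, hm⟩ := hwf.has_min Set.univ ⟨⟨β₀, hβ₀⟩, Set.mem_univ _⟩
      exact ⟨α, α.2, fun β hβ => hm ⟨β, hβ⟩ (Set.mem_univ _)⟩
    have h0 := congrArg (MvPolynomial.coeff (expo α)) hl
    rw [Finsupp.linearCombination_apply, Finsupp.sum, MvPolynomial.coeff_sum,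
      MvPolynomial.coeff_zero, Finset.sum_eq_single α] at h0
    · have hc := coeff_eq_zero (hp α) (α := α) (Lower.irrefl α)
      rw [MvPolynomial.coeff_sub, MvPolynomial.coeff_smul, coeff_expo_mono, if_pos rfl, sub_eq_zero]
        at hc
      rw [MvPolynomial.coeff_smul, hc, smul_eq_mul, smul_eq_mul, mul_one] at h0
      exact (mul_ne_zero (Finsupp.mem_support_iff.1 hα) (hu α)) h0
    · intro β hβ hne
      have hc := coeff_eq_zero (hp β) (α := α) (hmax β hβ)
      rw [MvPolynomial.coeff_sub, MvPolynomial.coeff_smul, coeff_expo_mono, if_neg hne, smul_zero,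
        sub_zero] at hc
      rw [MvPolynomial.coeff_smul, hc, smul_zero]
    · exact fun h => absurd hα h
  · have key : ∀ α, mono α ∈ Submodule.span ℚ (Set.range p) := by
      intro α
      induction α using wellFounded_lower.induction with
      | _ α ih =>
        have h1 : p α - u α • mono α ∈ Submodule.span ℚ (Set.range p) := by
          refine Submodule.span_le.2 ?_ (hp α)
          rintro _ ⟨δ, hδ, rfl⟩
          exact ih δ hδ
        have h2 : mono α = (u α)⁻¹ • (p α - (p α - u α • mono α)) := by
          rw [sub_sub_cancel, smul_smul, inv_mul_cancel₀ (hu α), one_smul]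
        rw [h2]
        exact Submodule.smul_mem _ _ (Submodule.sub_mem _ (Submodule.subset_span ⟨α, rfl⟩) h1)
    refine eq_top_iff.2 fun q _ => Submodule.span_le.2 ?_ (mem_monoSpan_univ q)
    rintro _ ⟨δ, -, rfl⟩
    exact key δ

/-! ### Reduction of `G` to polynomials -/

/-- The rules for the polynomial congruent to `G_γ` modulo `I`: the recursion for `G`, and
`F_β ∈ I` for all bicompositions `β ≠ 0`. -/
structure IsReduction (ρ : GBicomp → Poly) : Prop where
  zero : ρ 0 = 1
  bicomp : ∀ β, IsBicomp β → β ≠ 0 → ρ β = 0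
  map_phiX : ∀ i γ, Tail (i + 1) γ →
    ρ (phiX i γ) = ρ (γ + Finsupp.single i (1, 0)) - MvPolynomial.X (Sum.inl i) * ρ γ
  map_phiY₀ : ∀ i γ, Tail (i + 1) γ → (γ i).1 = 0 →
    ρ (phiY₀ i γ) = ρ (γ + Finsupp.single i (0, 1)) - MvPolynomial.X (Sum.inr i) * ρ γ

theorem tail_addX {i : ℕ} {γ : GBicomp} (h : Tail (i + 1) γ) :
    Tail i (γ + Finsupp.single i (1, 0)) := by
  intro j hj hz
  rw [addX_apply] at hz ⊢
  rcases hj.eq_or_lt with rfl | hj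
  · simp at hz
  · rw [if_neg (by omega)] at hz ⊢
    exact h j hj hz

theorem tail_addY {i : ℕ} {γ : GBicomp} (h : Tail (i + 1) γ) :
    Tail i (γ + Finsupp.single i (0, 1)) := by
  intro j hj hz
  rw [addY_apply] at hz ⊢
  rcases hj.eq_or_lt with rfl | hj
  · simp at hz
  · rw [if_neg (by omega)] at hz ⊢
    exact h j hj hz

theorem size_addX (i : ℕ) (γ : GBicomp) : size (γ + Finsupp.single i (1, 0)) = size γ + 1 := by
  rw [size_add, size_single, add_zero]

theorem size_addY (i : ℕ) (γ : GBicomp) : size (γ + Finsupp.single i (0, 1)) = size γ + 1 := by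
  rw [size_add, size_single, zero_add]

theorem size_phiX (i : ℕ) (γ : GBicomp) : size (phiX i γ) = size γ + 1 := by
  rw [phiX, size_addX, size_insertZero]

theorem size_phiY₀ (i : ℕ) (γ : GBicomp) : size (phiY₀ i γ) = size γ + 1 := by
  rw [phiY₀, size_addY, size_insertZero]

theorem size_phiY (i : ℕ) (γ : GBicomp) : size (phiY i γ) = size γ + 1 := by
  by_cases ha : (γ i).1 = 0
  · rw [phiY_of_eq ha, size_phiY₀]
  · rw [phiY_of_ne ha, size_phiY₀, size_insertZero]

theorem size_stage (n : ℕ) (c : ℕ × ℕ) (γ : GBicomp) :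
    size (stage n c γ) = size γ + c.1 + c.2 := by
  obtain ⟨a, b⟩ := c
  unfold stage
  induction a with
  | zero =>
    induction b with
    | zero => rfl
    | succ b ih =>
      simp only [Function.iterate_zero, id] at ih ⊢
      rw [Function.iterate_succ_apply', size_phiY, ih]
      ring
  | succ a ih =>
    simp only at ih ⊢
    rw [Function.iterate_succ_apply', size_phiX, ih]
    ring

/-- If the columns of `γ` from `n` on form a bicomposition, only variables with index `< n`
occur in `ρ γ`. -/
theorem IsReduction.mem {ρ : GBicomp → Poly} (hρ : IsReduction ρ) {n : ℕ} {γ : GBicomp}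
    (h : Tail n γ) : ρ γ ∈ monoSpan {δ | (∀ j, n ≤ j → δ j = 0) ∧ size δ = size γ} := by
  induction γ using G_induction generalizing n with
  | hb β hβ =>
    by_cases h0 : β = 0
    · subst h0
      rw [hρ.zero, ← mono_zero]
      exact mono_mem ⟨fun _ _ => rfl, rfl⟩
    · rw [hρ.bicomp β hβ h0]
      exact Submodule.zero_mem _
  | hX i γ ht ih1 ih2 =>
    have hin : i < n := by
      by_contra! hc
      obtain ⟨h0, h1⟩ := phiX_cols i γ
      have := h i hc h0
      rw [h1] at this
      simp at this
    rw [hρ.map_phiX i γ ht, ← mono_single_X, size_phiX]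
    refine Submodule.sub_mem _ ?_ (mono_mul_mem ?_ (ih1 (ht.mono hin)))
    · have := ih2 ((tail_addX ht).mono hin.le)
      rwa [size_addX] at this
    · rintro δ ⟨h1, h2⟩
      refine ⟨fun j hj => ?_, by rw [add_comm, size_addX, h2]⟩
      rw [add_comm, addX_apply, if_neg (by omega), h1 j hj]
  | hY i γ ht ha ih1 ih2 =>
    have hin : i < n := by
      by_contra! hc
      have h0 : phiY₀ i γ i = 0 := by simp [phiY₀_apply]
      have h1 : phiY₀ i γ (i + 1) = ((γ i).1, (γ i).2 + 1) := by simp [phiY₀_apply]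
      have := h i hc h0
      rw [h1] at this
      simp at this
    rw [hρ.map_phiY₀ i γ ht ha, ← mono_single_Y, size_phiY₀]
    refine Submodule.sub_mem _ ?_ (mono_mul_mem ?_ (ih1 (ht.mono hin)))
    · have := ih2 ((tail_addY ht).mono hin.le)
      rwa [size_addY] at this
    · rintro δ ⟨h1, h2⟩
      refine ⟨fun j hj => ?_, by rw [add_comm, size_addY, h2]⟩
      rw [add_comm, addY_apply, if_neg (by omega), h1 j hj]

/-- The exponents of degree `d` that have no nonzero column after column `n` and whose column `n`
is smaller than `c`. -/
def lowerAt (n : ℕ) (c : ℕ × ℕ) (d : ℕ) : Set GBicomp :=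
  {δ | (∀ j, n < j → δ j = 0) ∧ ColLT (δ n) c ∧ size δ = d}

theorem IsReduction.mem_lowerAt {ρ : GBicomp → Poly} (hρ : IsReduction ρ) {n d : ℕ}
    {γ : GBicomp} {c : ℕ × ℕ} (h : Tail n γ) (hc : c ≠ 0) (hd : size γ = d) :
    ρ γ ∈ monoSpan (lowerAt n c d) := by
  refine monoSpan_mono ?_ (hρ.mem h)
  rintro δ ⟨h1, h2⟩
  refine ⟨fun j hj => h1 j hj.le, ?_, h2.trans hd⟩
  rw [h1 n le_rfl]
  by_cases hc1 : c.1 = 0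
  · exact Or.inl ⟨hc1.symm, Nat.pos_of_ne_zero fun hc2 => hc (Prod.ext hc1 hc2)⟩
  · exact Or.inr (Or.inl ⟨Nat.pos_of_ne_zero hc1, rfl⟩)

/-- One application of `φ(y_n, ·)` before which no `φ(x_n, ·)` is applied. -/
theorem IsReduction.phiY_leading {ρ : GBicomp → Poly} (hρ : IsReduction ρ) {n : ℕ} {γ : GBicomp}
    (h : Tail n γ) : ρ (phiY n γ) + MvPolynomial.X (Sum.inr n) * ρ γ ∈
      monoSpan (lowerAt n (0, 1) (size γ + 1)) := by
  have h' := h.mono (Nat.le_succ n)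
  by_cases ha : (γ n).1 = 0
  · rw [phiY_of_eq ha, hρ.map_phiY₀ n γ h' ha, sub_add_cancel]
    exact hρ.mem_lowerAt (tail_addY h') (by simp) (size_addY n γ)
  · -- here `insertZero n γ` is itself `phiX n` of the index `δ` with one `x` less
    set δ := decX n γ with hδ
    have hadd : δ + Finsupp.single n (1, 0) = γ := by
      ext1 j
      rw [addX_apply, hδ, decX_apply, decX_apply, if_pos rfl]
      split_ifs with hj
      · subst hj
        exact Prod.ext (by simp only; omega) rfl
      · rfl
    have hins : insertZero n γ = phiX n δ := by
      ext1 j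
      rw [phiX_apply, insertZero_apply, hδ, decX_apply, decX_apply, decX_apply, if_pos rfl]
      split_ifs
      all_goals first | rfl | omega | skip
      rename_i hj
      subst hj
      rw [add_tsub_cancel_right]
      exact Prod.ext (by simp only; omega) rfl
    have hδt : Tail (n + 1) δ := by
      intro j hj hz
      rw [hδ, decX_apply, if_neg (by omega)] at hz ⊢
      exact h' j hj hz
    have hsz : size γ = size δ + 1 := by rw [← hadd, size_addX]
    have hit : Tail (n + 1) (insertZero n γ) :=
      tail_insertZero h' fun h0 => ha (by rw [h0]; rfl)
    have e1 : ρ (insertZero n γ) = ρ γ - MvPolynomial.X (Sum.inl n) * ρ δ := by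
      rw [hins, hρ.map_phiX n δ hδt, hadd]
    have e2 : ρ (phiY n γ) + MvPolynomial.X (Sum.inr n) * ρ γ =
        ρ (insertZero n γ + Finsupp.single n (0, 1)) + mono (Finsupp.single n (1, 1)) * ρ δ := by
      have : mono (Finsupp.single n (1, 1)) =
          MvPolynomial.X (Sum.inr n) * MvPolynomial.X (Sum.inl n) := by
        rw [← mono_single_X, ← mono_single_Y, mono_mul, ← Finsupp.single_add]
        rfl
      rw [phiY_of_ne ha, hρ.map_phiY₀ n _ hit (by simp [insertZero_apply]), e1, this]
      ring
    rw [e2]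
    refine Submodule.add_mem _ (hρ.mem_lowerAt (tail_addY hit) (by simp)
      (by rw [size_addY, size_insertZero])) (mono_mul_mem ?_ (hρ.mem hδt))
    rintro ε ⟨h1, h2⟩
    refine ⟨fun j hj => ?_, ?_, ?_⟩
    · rw [Finsupp.add_apply, Finsupp.single_eq_of_ne (by omega), h1 j hj, zero_add]
    · rw [Finsupp.add_apply, Finsupp.single_eq_same]
      exact Or.inr (Or.inr ⟨by simp, Nat.one_pos⟩)
    · rw [size_add, size_single, h2, hsz]
      ring

/-- Modulo smaller monomials, `stage n c` multiplies the reduction by `± x_n^{c₁} y_n^{c₂}`. -/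
theorem IsReduction.stage_leading {ρ : GBicomp → Poly} (hρ : IsReduction ρ) {n : ℕ}
    {γ : GBicomp} (h : Tail n γ) (c : ℕ × ℕ) :
    ρ (stage n c γ) - (-1 : ℚ) ^ (c.1 + c.2) • (mono (Finsupp.single n c) * ρ γ) ∈
      monoSpan (lowerAt n c (size γ + c.1 + c.2)) := by
  have h' := h.mono (Nat.le_succ n)
  obtain ⟨a, b⟩ := c
  induction a with
  | zero =>
    induction b with
    | zero =>
      have : ρ (stage n (0, 0) γ) -
          (-1 : ℚ) ^ (0 + 0) • (mono (Finsupp.single n (0, 0)) * ρ γ) = 0 := by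
        have : Finsupp.single n ((0, 0) : ℕ × ℕ) = 0 := Finsupp.single_zero n
        rw [this, mono_zero]
        simp [stage]
      rw [this]
      exact Submodule.zero_mem _
    | succ b ih =>
      have hst : stage n (0, b + 1) γ = phiY n (stage n (0, b) γ) := by
        simp only [stage, Function.iterate_zero, id]
        rw [Function.iterate_succ_apply']
      have hm : mono (Finsupp.single n (0, b + 1)) =
          MvPolynomial.X (Sum.inr n) * mono (Finsupp.single n (0, b)) := by
        rw [← mono_single_Y, mono_mul, ← Finsupp.single_add, Prod.mk_add_mk, zero_add, add_comm 1]
      rw [hst, hm]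
      set u := stage n (0, b) γ with hu
      set m := mono (Finsupp.single n (0, b))
      have e : ρ (phiY n u) - (-1 : ℚ) ^ ((0, b + 1).1 + (0, b + 1).2) •
            (MvPolynomial.X (Sum.inr n) * m * ρ γ) =
          (ρ (phiY n u) + MvPolynomial.X (Sum.inr n) * ρ u) - mono (Finsupp.single n (0, 1)) *
            (ρ u - (-1 : ℚ) ^ ((0, b).1 + (0, b).2) • (m * ρ γ)) := by
        simp only [zero_add, pow_succ, mono_single_Y, MvPolynomial.smul_eq_C_mul, map_mul, map_neg,
          map_one]
        ring
      rw [e]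
      refine Submodule.sub_mem _ ?_ (mono_mul_mem ?_ ih)
      · rcases Nat.eq_zero_or_pos b with rfl | hb
        · exact hρ.phiY_leading h
        · have hu0 : u n = 0 := by
            obtain ⟨b', rfl⟩ := Nat.exists_eq_succ_of_ne_zero hb.ne'
            rw [hu, stage]
            simp only [Function.iterate_zero, id]
            rw [Function.iterate_succ_apply']
            exact (phiY_cols n _).1
          have hux : (u n).1 = 0 := by rw [hu0]; rfl
          have hut : Tail (n + 1) u := tail_stage h' _
          rw [phiY_of_eq hux, hρ.map_phiY₀ n u hut hux, sub_add_cancel]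
          refine hρ.mem_lowerAt (tail_addY hut) (by simp) ?_
          rw [size_addY, hu, size_stage]
          rfl
      · rintro δ ⟨h1, h2, h3⟩
        refine ⟨fun j hj => ?_, ?_, ?_⟩
        · rw [Finsupp.add_apply, Finsupp.single_eq_of_ne (by omega), h1 j hj, zero_add]
        · rw [Finsupp.add_apply, Finsupp.single_eq_same]
          simp only [ColLT, Prod.fst_add, Prod.snd_add] at h2 ⊢
          omega
        · rw [size_add, size_single, h3]
          simp only
          ring
  | succ a ih =>
    have hst : stage n (a + 1, b) γ = phiX n (stage n (a, b) γ) := by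
      simp only [stage]
      rw [Function.iterate_succ_apply']
    have hm : mono (Finsupp.single n (a + 1, b)) =
        MvPolynomial.X (Sum.inl n) * mono (Finsupp.single n (a, b)) := by
      rw [← mono_single_X, mono_mul, ← Finsupp.single_add, Prod.mk_add_mk, zero_add, add_comm 1]
    rw [hst, hm]
    set u := stage n (a, b) γ with hu
    set m := mono (Finsupp.single n (a, b))
    have hut : Tail (n + 1) u := tail_stage h' _
    have e : ρ (phiX n u) - (-1 : ℚ) ^ ((a + 1, b).1 + (a + 1, b).2) •
          (MvPolynomial.X (Sum.inl n) * m * ρ γ) =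
        ρ (u + Finsupp.single n (1, 0)) - mono (Finsupp.single n (1, 0)) *
          (ρ u - (-1 : ℚ) ^ ((a, b).1 + (a, b).2) • (m * ρ γ)) := by
      rw [hρ.map_phiX n u hut]
      simp only [show a + 1 + b = (a + b) + 1 by ring, pow_succ, mono_single_X,
        MvPolynomial.smul_eq_C_mul, map_mul, map_neg, map_one]
      ring
    rw [e]
    refine Submodule.sub_mem _ (hρ.mem_lowerAt (tail_addX hut) (by simp) ?_) (mono_mul_mem ?_ ih)
    · rw [size_addX, hu, size_stage]
      simp only
      ring
    · rintro δ ⟨h1, h2, h3⟩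
      refine ⟨fun j hj => ?_, ?_, ?_⟩
      · rw [Finsupp.add_apply, Finsupp.single_eq_of_ne (by omega), h1 j hj, zero_add]
      · rw [Finsupp.add_apply, Finsupp.single_eq_same]
        simp only [ColLT, Prod.fst_add, Prod.snd_add] at h2 ⊢
        omega
      · rw [size_add, size_single, h3]
        simp only
        ring

theorem size_PhiAux_zero {α : GBicomp} {n : ℕ} (h : len α ≤ n) : size (PhiAux α 0 n) = size α := by
  induction n generalizing α with
  | zero =>
    have : α = 0 := by
      ext1 j
      exact eq_zero_of_len_le (h.trans (Nat.zero_le j))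
    rw [this]
    rfl
  | succ n ih =>
    have hl : len (α.erase n) ≤ n := len_le fun j hj => by
      by_contra! hc
      rcases hc.eq_or_lt with rfl | hc
      · simp at hj
      · rw [Finsupp.erase_ne (by omega), eq_zero_of_len_le (h.trans hc)] at hj
        exact hj rfl
    rw [PhiAux_succ, size_stage, PhiAux_congr 0 (α' := α.erase n) fun j hj => by
      rw [Finsupp.erase_ne (by omega)], ih hl]
    conv_rhs => rw [← Finsupp.single_add_erase n α]
    rw [size_add, size_single]
    ring

theorem IsReduction.PhiAux_leading {ρ : GBicomp → Poly} (hρ : IsReduction ρ) {α : GBicomp}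
    {n : ℕ} (h : len α ≤ n) :
    ρ (PhiAux α 0 n) - (-1 : ℚ) ^ size α • mono α ∈ monoSpan {δ | Lower δ α} := by
  induction n generalizing α with
  | zero =>
    have : α = 0 := by
      ext1 j
      exact eq_zero_of_len_le (h.trans (Nat.zero_le j))
    subst this
    have : ρ (PhiAux 0 0 0) - (-1 : ℚ) ^ size (0 : GBicomp) • mono 0 = 0 := by
      rw [mono_zero]
      simp [PhiAux, hρ.zero, size]
    rw [this]
    exact Submodule.zero_mem _
  | succ n ih =>
    set α' := α.erase n with hα'
    have hαn : α' n = 0 := Finsupp.erase_same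
    have hl : len α' ≤ n := len_le fun j hj => by
      by_contra! hc
      rcases hc.eq_or_lt with rfl | hc
      · exact hj hαn
      · rw [hα', Finsupp.erase_ne (by omega), eq_zero_of_len_le (h.trans hc)] at hj
        exact hj rfl
    have hα : Finsupp.single n (α n) + α' = α := Finsupp.single_add_erase n α
    have hs : size α = size α' + ((α n).1 + (α n).2) := by
      conv_lhs => rw [← hα]
      rw [size_add, size_single, add_comm]
    have hP : PhiAux α 0 n = PhiAux α' 0 n := PhiAux_congr 0 fun j hj => by
      rw [hα', Finsupp.erase_ne (by omega)]
    have h1 := ih hl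
    have h2 := hρ.stage_leading (tail_PhiAux isBicomp_zero α' n) (α n)
    rw [size_PhiAux_zero hl] at h2
    rw [PhiAux_succ, hP]
    have e : ρ (stage n (α n) (PhiAux α' 0 n)) - (-1 : ℚ) ^ size α • mono α =
        (ρ (stage n (α n) (PhiAux α' 0 n)) - (-1 : ℚ) ^ ((α n).1 + (α n).2) •
          (mono (Finsupp.single n (α n)) * ρ (PhiAux α' 0 n))) +
        (-1 : ℚ) ^ ((α n).1 + (α n).2) • (mono (Finsupp.single n (α n)) *
          (ρ (PhiAux α' 0 n) - (-1 : ℚ) ^ size α' • mono α')) := by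
      rw [hs, mul_sub, mul_smul_comm, mono_mul, hα, smul_sub, smul_smul, ← pow_add,
        add_comm (size α')]
      abel
    rw [e]
    refine Submodule.add_mem _ (monoSpan_mono ?_ h2)
      (Submodule.smul_mem _ _ (mono_mul_mem ?_ h1))
    · rintro δ ⟨d1, d2, d3⟩
      exact ⟨⟨n, d2, fun j hj => by rw [d1 j hj, eq_zero_of_len_le (h.trans hj)]⟩,
        by rw [d3, hs, add_assoc]⟩
    · rintro δ ⟨⟨k, d1, d2⟩, d3⟩
      have hkn : k ≠ n := by
        rintro rfl
        exact d1.ne_zero hαn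
      refine ⟨⟨k, ?_, fun j hj => ?_⟩, ?_⟩
      · conv_rhs => rw [← hα]
        rwa [Finsupp.add_apply, Finsupp.add_apply, Finsupp.single_eq_of_ne hkn, zero_add, zero_add]
      · conv_rhs => rw [← hα]
        rw [Finsupp.add_apply, Finsupp.add_apply, d2 j hj]
      · rw [size_add, size_single, d3, hs]
        ring

/-- The reductions of the `G_γ` with `γ = Φ(X^α F_0)` form a basis of `ℚ[x, y]`. -/
theorem IsReduction.basis {ρ : GBicomp → Poly} (hρ : IsReduction ρ) :
    LinearIndependent ℚ (fun α => ρ (Phi α 0)) ∧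
      Submodule.span ℚ (Set.range fun α => ρ (Phi α 0)) = ⊤ :=
  basis_of_leading (u := fun α => (-1 : ℚ) ^ size α)
    (fun _ => pow_ne_zero _ (neg_ne_zero.2 one_ne_zero)) fun _ => hρ.PhiAux_leading le_rfl

/-! ### Splitting off the first column -/

/-- Put the column `c` in front of `γ`; `deleteCol 0` undoes this. -/
def cons (c : ℕ × ℕ) (γ : GBicomp) : GBicomp := Finsupp.single 0 c + insertZero 0 γ

@[simp] theorem cons_apply_zero (c : ℕ × ℕ) (γ : GBicomp) : cons c γ 0 = c := by
  simp [cons, insertZero_apply]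

@[simp] theorem cons_apply_succ (c : ℕ × ℕ) (γ : GBicomp) (j : ℕ) : cons c γ (j + 1) = γ j := by
  simp [cons, insertZero_apply]

@[simp] theorem deleteCol_zero_apply (γ : GBicomp) (j : ℕ) : deleteCol 0 γ j = γ (j + 1) := by
  simp [deleteCol_apply]

theorem cons_ext {γ δ : GBicomp} (h0 : γ 0 = δ 0) (h : ∀ j, γ (j + 1) = δ (j + 1)) : γ = δ := by
  ext1 j
  cases j with
  | zero => exact h0
  | succ j => exact h j

@[simp] theorem cons_deleteCol (γ : GBicomp) : cons (γ 0) (deleteCol 0 γ) = γ :=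
  cons_ext (by simp) fun j => by simp

@[simp] theorem deleteCol_cons (c : ℕ × ℕ) (γ : GBicomp) : deleteCol 0 (cons c γ) = γ := by
  ext1 j
  simp

theorem cons_zero_eq (γ : GBicomp) : cons 0 γ = insertZero 0 γ := by
  rw [cons, Finsupp.single_zero, zero_add]

theorem cons_injective (c : ℕ × ℕ) : Function.Injective (cons c) := fun γ δ h => by
  rw [← deleteCol_cons c γ, h, deleteCol_cons]

theorem isBicomp_cons {c : ℕ × ℕ} {γ : GBicomp} (hc : c ≠ 0) (h : IsBicomp γ) :
    IsBicomp (cons c γ) := by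
  rw [isBicomp_iff_tail] at h ⊢
  intro j _ hj
  cases j with
  | zero => exact absurd (by simpa using hj) hc
  | succ j =>
    rw [cons_apply_succ] at hj ⊢
    exact h j (Nat.zero_le j) hj

theorem Tail.deleteCol {n : ℕ} {γ : GBicomp} (h : Tail (n + 1) γ) : Tail n (deleteCol 0 γ) := by
  intro j hj hz
  rw [deleteCol_zero_apply] at hz ⊢
  exact h (j + 1) (by omega) hz

theorem IsBicomp.deleteCol {γ : GBicomp} (h : IsBicomp γ) : IsBicomp (deleteCol 0 γ) :=
  isBicomp_iff_tail.2 ((isBicomp_iff_tail.1 h).mono (Nat.zero_le 1)).deleteCol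

theorem IsBicomp.lt_len_iff {γ : GBicomp} (h : IsBicomp γ) {j : ℕ} : j < len γ ↔ γ j ≠ 0 :=
  ⟨h j, lt_len⟩

theorem IsBicomp.zero_ne {γ : GBicomp} (h : IsBicomp γ) (h0 : γ ≠ 0) : γ 0 ≠ 0 := by
  intro hz
  refine h0 ?_
  ext1 j
  exact (isBicomp_iff_tail.1 h).zero_of_le le_rfl hz (Nat.zero_le j)

/-! ### The order on bicompositions -/

theorem merge_apply (k : ℕ) (α : GBicomp) (j : ℕ) :
    merge k α j = if j < k then α j else if j = k then α k + α (k + 1) else α (j + 1) := by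
  have key : ∀ α : GBicomp, merge k α j =
      if j < k then α j else if j = k then α k + α (k + 1) else α (j + 1) := by
    intro α
    induction α using Finsupp.induction_linear with
    | zero => simp [merge]
    | add f g hf hg =>
      rw [merge, Finsupp.mapDomain_add, Finsupp.add_apply]
      rw [merge] at hf hg
      rw [hf, hg]
      simp only [Finsupp.add_apply]
      split_ifs
      · rfl
      · abel
      · rfl
    | single i c =>
      rw [merge, Finsupp.mapDomain_single]
      simp only [Finsupp.single_apply]
      split_ifs <;> first | rfl | omega | simp
  exact key α

theorem merge_succ (k : ℕ) (α : GBicomp) :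
    merge (k + 1) α = cons (α 0) (merge k (deleteCol 0 α)) := by
  refine cons_ext ?_ fun j => ?_
  · simp [merge_apply]
  · simp only [merge_apply, cons_apply_succ, deleteCol_zero_apply, add_lt_add_iff_right,
      add_left_inj]

theorem merge_zero (α : GBicomp) :
    merge 0 α = cons (α 0 + α 1) (deleteCol 0 (deleteCol 0 α)) := by
  refine cons_ext ?_ fun j => ?_ <;> simp [merge_apply]

theorem covers_cons {c : ℕ × ℕ} (hc : c ≠ 0) {α β : GBicomp} (h : Covers α β) :
    Covers (cons c α) (cons c β) := by
  obtain ⟨hα, k, hk, hk', rfl⟩ := h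
  refine ⟨isBicomp_cons hc hα, k + 1, ?_, by simpa using hk', by simp [merge_succ]⟩
  rw [(isBicomp_cons hc hα).lt_len_iff, cons_apply_succ]
  exact hα.lt_len_iff.1 hk

theorem refines_cons {c : ℕ × ℕ} (hc : c ≠ 0) {α β : GBicomp} (h : Refines α β) :
    Refines (cons c α) (cons c β) :=
  Relation.ReflTransGen.lift (cons c) (fun _ _ h => covers_cons hc h) _ _ h

theorem refines_cons_cons {c d : ℕ × ℕ} (hc : c ≠ 0) (hd : d ≠ 0) (hcd : c.2 = 0 ∨ d.1 = 0)
    {α β : GBicomp} (hβ : IsBicomp β) (h : Refines α (cons d β)) :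
    Refines (cons c α) (cons (c + d) β) := by
  refine (refines_cons hc h).tail ⟨isBicomp_cons hc (isBicomp_cons hd hβ), 0, ?_, ?_, ?_⟩
  · rw [(isBicomp_cons hc (isBicomp_cons hd hβ)).lt_len_iff]
    simpa using hd
  · simpa using hcd
  · rw [merge_zero]
    have : cons c (cons d β) 1 = d := by
      rw [show (1 : ℕ) = 0 + 1 from rfl, cons_apply_succ, cons_apply_zero]
    rw [this]
    simp

theorem refines_isBicomp {α β : GBicomp} (h : Refines α β) (hβ : IsBicomp β) : IsBicomp α := by
  rcases Relation.ReflTransGen.cases_head h with rfl | ⟨γ, h, -⟩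
  · exact hβ
  · exact h.1

theorem refines_size {α β : GBicomp} (h : Refines α β) : size α = size β := by
  induction h with
  | refl => rfl
  | tail _ h ih =>
    obtain ⟨-, k, -, -, rfl⟩ := h
    rw [ih, size_merge]

/-- How a refinement of `b β` starts: with `b`, or with a proper initial part `c` of `b`. -/
theorem refines_cons_cases {α β : GBicomp} {b : ℕ × ℕ} (hβ : IsBicomp β)
    (h : Refines α (cons b β)) :
    (α 0 = b ∧ Refines (deleteCol 0 α) β) ∨ ∃ d, d ≠ 0 ∧ α 0 + d = b ∧
      ((α 0).2 = 0 ∨ d.1 = 0) ∧ Refines (deleteCol 0 α) (cons d β) := by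
  induction h using Relation.ReflTransGen.head_induction_on with
  | refl => exact Or.inl ⟨by simp, by rw [deleteCol_cons]; exact Relation.ReflTransGen.refl⟩
  | @head α γ h _ ih =>
    obtain ⟨hα, k, hk, hk', rfl⟩ := h
    rw [hα.lt_len_iff] at hk
    cases k with
    | succ k =>
      rw [merge_succ, cons_apply_zero, deleteCol_cons] at ih
      have hcov : Covers (deleteCol 0 α) (merge k (deleteCol 0 α)) :=
        ⟨hα.deleteCol, k, by rw [hα.deleteCol.lt_len_iff]; simpa using hk, by simpa using hk', rfl⟩
      rcases ih with ⟨h1, h2⟩ | ⟨d, h1, h2, h3, h4⟩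
      · exact Or.inl ⟨h1, h2.head hcov⟩
      · exact Or.inr ⟨d, h1, h2, h3, h4.head hcov⟩
    | zero =>
      rw [merge_zero, cons_apply_zero, deleteCol_cons] at ih
      rw [zero_add] at hk hk'
      have he : deleteCol 0 α = cons (α 1) (deleteCol 0 (deleteCol 0 α)) := by
        conv_lhs => rw [← cons_deleteCol (deleteCol 0 α)]
        rw [deleteCol_zero_apply]
      rw [he]
      rcases ih with ⟨h1, h2⟩ | ⟨d, h1, h2, h3, h4⟩
      · exact Or.inr ⟨α 1, hk, h1, hk', refines_cons hk h2⟩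
      · refine Or.inr ⟨α 1 + d, ?_, by rw [← add_assoc, h2], ?_,
          refines_cons_cons hk h1 ?_ hβ h4⟩
        · intro h0
          exact hk (Prod.ext (by have := congrArg Prod.fst h0; simp at this; simp [this.1])
            (by have := congrArg Prod.snd h0; simp at this; simp [this.1]))
        · simp only [Prod.snd_add, Prod.fst_add] at h3 ⊢
          omega
        · simp only [Prod.snd_add] at h3
          omega

/-- The word `x^{c₁} y^{c₂}` is a prefix of the word `x^{b₁} y^{b₂}`. -/
def Pre (c b : ℕ × ℕ) : Prop := c.1 ≤ b.1 ∧ c.2 ≤ b.2 ∧ (c.1 = b.1 ∨ c.2 = 0)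

theorem refines_cons_self_iff {α β : GBicomp} {b : ℕ × ℕ} (hb : b ≠ 0) (hβ : IsBicomp β) :
    Refines (cons b α) (cons b β) ↔ Refines α β := by
  refine ⟨fun h => ?_, refines_cons hb⟩
  rcases refines_cons_cases hβ h with ⟨-, h⟩ | ⟨d, h0, h, -⟩
  · rwa [deleteCol_cons] at h
  · rw [cons_apply_zero] at h
    exact absurd (by simpa using h) h0

theorem refines_cons_iff {α β : GBicomp} {b c : ℕ × ℕ} (hb : b ≠ 0) (hc : c ≠ 0) (hcb : c ≠ b)
    (hβ : IsBicomp β) :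
    Refines (cons c α) (cons b β) ↔ Pre c b ∧ Refines α (cons (b - c) β) := by
  constructor
  · intro h
    rcases refines_cons_cases hβ h with ⟨h, -⟩ | ⟨d, h0, h1, h2, h3⟩
    · exact absurd (by simpa using h) hcb
    · rw [cons_apply_zero] at h1 h2
      rw [deleteCol_cons] at h3
      subst h1
      refine ⟨?_, by rwa [add_tsub_cancel_left]⟩
      simp only [Pre, Prod.fst_add, Prod.snd_add]
      omega
  · rintro ⟨⟨h1, h2, h3⟩, h⟩
    have hbc : c + (b - c) = b := add_tsub_cancel_of_le (Prod.mk_le_mk.2 ⟨h1, h2⟩)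
    have h0 : b - c ≠ 0 := fun h0 => hcb (by rw [h0, add_zero] at hbc; exact hbc)
    have := refines_cons_cons hc h0 (by simp only [Prod.fst_sub]; omega) hβ h
    rwa [hbc] at this

theorem refines_zero {α : GBicomp} (h : Refines α 0) : α = 0 :=
  size_eq_zero (refines_size h)

/-! ### Coefficients with respect to the first two variables -/

theorem expo_cons (c : ℕ × ℕ) (δ : GBicomp) :
    expo (cons c δ) = Finsupp.single (Sum.inl 0) c.1 + Finsupp.single (Sum.inr 0) c.2 +
      (expo δ).mapDomain (Sum.map Nat.succ Nat.succ) := by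
  have hinj : Function.Injective (Sum.map Nat.succ Nat.succ) :=
    Function.Injective.sumMap Nat.succ_injective Nat.succ_injective
  ext s
  rcases s with j | j
  · rw [expo_inl, Finsupp.add_apply, Finsupp.add_apply]
    cases j with
    | zero =>
      rw [Finsupp.mapDomain_of_notMem_range _ _ (by rintro ⟨a | a, h⟩ <;> simp at h)]
      simp
    | succ j =>
      have := Finsupp.mapDomain_apply hinj (expo δ) (Sum.inl j)
      simp only [Sum.map_inl, Nat.succ_eq_add_one] at this
      rw [this, expo_inl]
      simp
  · rw [expo_inr, Finsupp.add_apply, Finsupp.add_apply]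
    cases j with
    | zero =>
      rw [Finsupp.mapDomain_of_notMem_range _ _ (by rintro ⟨a | a, h⟩ <;> simp at h)]
      simp
    | succ j =>
      have := Finsupp.mapDomain_apply hinj (expo δ) (Sum.inr j)
      simp only [Sum.map_inr, Nat.succ_eq_add_one] at this
      rw [this, expo_inr]
      simp

theorem series_ext {f g : R}
    (h : ∀ δ, MvPowerSeries.coeff (expo δ) f = MvPowerSeries.coeff (expo δ) g) : f = g := by
  ext m
  obtain ⟨δ, rfl⟩ := expo_surjective m
  exact h δ

/-- The coefficient of `x₀^{c₁} y₀^{c₂}` in `f`, a series in the remaining variables, which are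
renumbered from `0`. -/
def firstCoeff (c : ℕ × ℕ) : R →ₗ[ℚ] R where
  toFun f := fun m => MvPowerSeries.coeff (Finsupp.single (Sum.inl 0) c.1 +
    Finsupp.single (Sum.inr 0) c.2 + m.mapDomain (Sum.map Nat.succ Nat.succ)) f
  map_add' _ _ := rfl
  map_smul' _ _ := rfl

theorem coeff_firstCoeff (c : ℕ × ℕ) (f : R) (δ : GBicomp) :
    MvPowerSeries.coeff (expo δ) (firstCoeff c f) = MvPowerSeries.coeff (expo (cons c δ)) f := by
  rw [expo_cons]
  rfl

theorem coeff_x_mul (i : ℕ) (f : R) (δ : GBicomp) :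
    MvPowerSeries.coeff (expo δ) (x i * f) =
      if (δ i).1 = 0 then 0 else MvPowerSeries.coeff (expo (decX i δ)) f := by
  rw [x, MvPowerSeries.X]
  split_ifs with h
  · rw [MvPowerSeries.coeff_monomial_mul, if_neg]
    intro hle
    have := hle (Sum.inl i)
    rw [expo_inl, h] at this
    simp at this
  · have hδ : δ = Finsupp.single i (1, 0) + decX i δ := by
      ext1 j
      rw [add_comm, addX_apply, decX_apply, decX_apply, if_pos rfl]
      split_ifs with hj
      · subst hj
        exact Prod.ext (by simp only; omega) rfl
      · rfl
    conv_lhs => rw [hδ, expo_add, expo_single, Finsupp.single_zero, add_zero]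
    rw [MvPowerSeries.coeff_add_monomial_mul, one_mul]

theorem coeff_y_mul (i : ℕ) (f : R) (δ : GBicomp) :
    MvPowerSeries.coeff (expo δ) (y i * f) =
      if (δ i).2 = 0 then 0 else MvPowerSeries.coeff (expo (decY i δ)) f := by
  rw [y, MvPowerSeries.X]
  split_ifs with h
  · rw [MvPowerSeries.coeff_monomial_mul, if_neg]
    intro hle
    have := hle (Sum.inr i)
    rw [expo_inr, h] at this
    simp at this
  · have hδ : δ = Finsupp.single i (0, 1) + decY i δ := by
      ext1 j
      rw [add_comm, addY_apply, decY_apply, decY_apply, if_pos rfl]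
      split_ifs with hj
      · subst hj
        exact Prod.ext rfl (by simp only; omega)
      · rfl
    conv_lhs => rw [hδ, expo_add, expo_single, Finsupp.single_zero, zero_add]
    rw [MvPowerSeries.coeff_add_monomial_mul, one_mul]

theorem firstCoeff_x_succ_mul (c : ℕ × ℕ) (i : ℕ) (f : R) :
    firstCoeff c (x (i + 1) * f) = x i * firstCoeff c f := by
  refine series_ext fun δ => ?_
  have : decX (i + 1) (cons c δ) = cons c (decX i δ) :=
    cons_ext (by simp [decX_apply]) fun j => by simp [decX_apply]
  rw [coeff_firstCoeff, coeff_x_mul, coeff_x_mul, coeff_firstCoeff, cons_apply_succ, this]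

theorem firstCoeff_y_succ_mul (c : ℕ × ℕ) (i : ℕ) (f : R) :
    firstCoeff c (y (i + 1) * f) = y i * firstCoeff c f := by
  refine series_ext fun δ => ?_
  have : decY (i + 1) (cons c δ) = cons c (decY i δ) :=
    cons_ext (by simp [decY_apply]) fun j => by simp [decY_apply]
  rw [coeff_firstCoeff, coeff_y_mul, coeff_y_mul, coeff_firstCoeff, cons_apply_succ, this]

theorem firstCoeff_x_zero_mul (c : ℕ × ℕ) (f : R) :
    firstCoeff c (x 0 * f) = if c.1 = 0 then 0 else firstCoeff (c.1 - 1, c.2) f := by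
  refine series_ext fun δ => ?_
  have : decX 0 (cons c δ) = cons (c.1 - 1, c.2) δ :=
    cons_ext (by simp [decX_apply]) fun j => by simp [decX_apply]
  rw [coeff_firstCoeff, coeff_x_mul, cons_apply_zero, this]
  split_ifs
  · rfl
  · rw [coeff_firstCoeff]

theorem firstCoeff_y_zero_mul (c : ℕ × ℕ) (f : R) :
    firstCoeff c (y 0 * f) = if c.2 = 0 then 0 else firstCoeff (c.1, c.2 - 1) f := by
  refine series_ext fun δ => ?_
  have : decY 0 (cons c δ) = cons (c.1, c.2 - 1) δ :=
    cons_ext (by simp [decY_apply]) fun j => by simp [decY_apply]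
  rw [coeff_firstCoeff, coeff_y_mul, cons_apply_zero, this]
  split_ifs
  · rfl
  · rw [coeff_firstCoeff]

theorem firstCoeff_one (c : ℕ × ℕ) : firstCoeff c 1 = if c = 0 then 1 else 0 := by
  refine series_ext fun δ => ?_
  have h0 : ∀ ε : GBicomp, expo ε = 0 ↔ ε = 0 := fun ε =>
    ⟨fun h => expo_injective h, fun h => by rw [h]; rfl⟩
  rw [coeff_firstCoeff, MvPowerSeries.coeff_one]
  have hcons : cons c δ = 0 ↔ c = 0 ∧ δ = 0 := by
    constructor
    · intro h
      have h1 := cons_apply_zero c δ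
      rw [h] at h1
      refine ⟨h1.symm, ?_⟩
      rw [← deleteCol_cons c δ, h]
      ext1 j
      simp
    · rintro ⟨rfl, rfl⟩
      exact cons_ext (by simp) fun j => by simp
  simp only [h0, hcons]
  by_cases hc : c = 0
  · simp only [hc, true_and, if_true]
    rw [MvPowerSeries.coeff_one]
    simp only [h0]
  · simp [hc]

theorem coeff_M (α δ : GBicomp) [Decidable (∃ i : ℕ → ℕ, StrictMono i ∧ δ = α.mapDomain i)] :
    MvPowerSeries.coeff (expo δ) (M α) =
      if ∃ i : ℕ → ℕ, StrictMono i ∧ δ = α.mapDomain i then 1 else 0 := by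
  have : MvPowerSeries.coeff (expo δ) (M α) = M α (expo δ) := rfl
  rw [this, M]
  simp only [expo_injective.eq_iff]

theorem M_zero : M 0 = 1 := by
  classical
  refine series_ext fun δ => ?_
  have h0 : expo δ = 0 ↔ δ = 0 := ⟨fun h => expo_injective h, fun h => by rw [h]; rfl⟩
  rw [coeff_M, MvPowerSeries.coeff_one]
  simp only [Finsupp.mapDomain_zero, h0]
  congr 1
  exact propext ⟨fun ⟨_, _, h⟩ => h, fun h => ⟨id, strictMono_id, h⟩⟩

theorem mapDomain_shift (α : GBicomp) {i i' : ℕ → ℕ} (h : ∀ j, i j = i' j + 1) :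
    α.mapDomain i = cons 0 (α.mapDomain i') := by
  rw [cons_zero_eq, insertZero, ← Finsupp.mapDomain_comp]
  congr 1
  funext j
  simp [skip, h]

theorem mapDomain_cons (c : ℕ × ℕ) (α : GBicomp) {i i' : ℕ → ℕ} (h0 : i 0 = 0)
    (h : ∀ j, i (j + 1) = i' j + 1) : (cons c α).mapDomain i = cons c (α.mapDomain i') := by
  rw [cons, cons, Finsupp.mapDomain_add, Finsupp.mapDomain_single, h0, insertZero, insertZero,
    ← Finsupp.mapDomain_comp, ← Finsupp.mapDomain_comp]
  congr 2
  funext j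
  simp [skip, h]

theorem exists_mapDomain_cons_zero {α δ : GBicomp} (hα : α 0 ≠ 0) :
    (∃ i : ℕ → ℕ, StrictMono i ∧ cons 0 δ = α.mapDomain i) ↔
      ∃ i : ℕ → ℕ, StrictMono i ∧ δ = α.mapDomain i := by
  constructor
  · rintro ⟨i, hi, h⟩
    have h0 : i 0 ≠ 0 := by
      intro h0
      have := Finsupp.mapDomain_apply hi.injective α 0
      rw [h0, ← h, cons_apply_zero] at this
      exact hα this.symm
    have hpos : ∀ j, i j = (i j - 1) + 1 := fun j => by
      have := hi.monotone (Nat.zero_le j)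
      omega
    refine ⟨fun j => i j - 1, fun a b hab => ?_, ?_⟩
    · have := hi hab
      have := hpos a
      simp only
      omega
    · exact cons_injective 0 (h.trans (mapDomain_shift α hpos))
  · rintro ⟨i, hi, rfl⟩
    exact ⟨fun j => i j + 1, fun a b hab => Nat.succ_lt_succ (hi hab),
      (mapDomain_shift α fun _ => rfl).symm⟩

theorem exists_mapDomain_cons {α δ : GBicomp} {c : ℕ × ℕ} (hc : c ≠ 0) :
    (∃ i : ℕ → ℕ, StrictMono i ∧ cons c δ = α.mapDomain i) ↔
      c = α 0 ∧ ∃ i : ℕ → ℕ, StrictMono i ∧ δ = (deleteCol 0 α).mapDomain i := by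
  constructor
  · rintro ⟨i, hi, h⟩
    have h0 : i 0 = 0 := by
      by_contra h0
      have : α.mapDomain i 0 = 0 := by
        refine Finsupp.mapDomain_of_notMem_range α 0 ?_
        rintro ⟨j, hj⟩
        have := hi.monotone (Nat.zero_le j)
        omega
      rw [← h, cons_apply_zero] at this
      exact hc this
    have hpos : ∀ j, i (j + 1) = (i (j + 1) - 1) + 1 := fun j => by
      have : i 0 < i (j + 1) := hi (Nat.succ_pos j)
      omega
    rw [← cons_deleteCol α, mapDomain_cons _ _ h0 hpos] at h
    have hc' := congrArg (fun γ : GBicomp => γ 0) h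
    simp only [cons_apply_zero] at hc'
    refine ⟨hc', fun j => i (j + 1) - 1, fun a b hab => ?_, ?_⟩
    · have h1 : i (a + 1) < i (b + 1) := hi (Nat.succ_lt_succ hab)
      have h2 := hpos a
      show i (a + 1) - 1 < i (b + 1) - 1
      omega
    · rw [← hc'] at h
      exact cons_injective c h
  · rintro ⟨rfl, i, hi, rfl⟩
    refine ⟨fun j => Nat.casesOn j 0 fun j => i j + 1, ?_, ?_⟩
    · intro a b hab
      cases a <;> cases b
      · exact absurd hab (lt_irrefl _)
      · exact Nat.succ_pos _
      · exact absurd hab (Nat.not_lt_zero _)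
      · exact Nat.succ_lt_succ (hi (Nat.lt_of_succ_lt_succ hab))
    · conv_rhs => rw [← cons_deleteCol α]
      rw [mapDomain_cons (i' := i) _ _ rfl fun _ => rfl]

theorem firstCoeff_zero_M {α : GBicomp} (hα : α 0 ≠ 0) : firstCoeff 0 (M α) = M α := by
  classical
  refine series_ext fun δ => ?_
  rw [coeff_firstCoeff, coeff_M, coeff_M]
  simp only [exists_mapDomain_cons_zero hα]

theorem firstCoeff_M {c : ℕ × ℕ} (hc : c ≠ 0) (α : GBicomp) :
    firstCoeff c (M α) = if c = α 0 then M (deleteCol 0 α) else 0 := by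
  classical
  refine series_ext fun δ => ?_
  rw [coeff_firstCoeff, coeff_M]
  simp only [exists_mapDomain_cons hc]
  by_cases h : c = α 0
  · simp only [h, true_and, if_true]
    rw [coeff_M]
  · simp [h]

theorem F_eq_sum (β : GBicomp) : F β = ∑ α ∈ (finite_refines β).toFinset, M α :=
  finsum_mem_eq_finite_toFinset_sum _ _

theorem F_zero : F 0 = 1 := by
  have : (finite_refines 0).toFinset = {0} := by
    ext α
    simp only [Set.Finite.mem_toFinset, Set.mem_ofPred_eq, Finset.mem_singleton]
    exact ⟨refines_zero, fun h => h ▸ Relation.ReflTransGen.refl⟩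
  rw [F_eq_sum, this, Finset.sum_singleton, M_zero]

theorem firstCoeff_F_eq {β β' : GBicomp} {c : ℕ × ℕ} (hc : c ≠ 0)
    (h : ∀ α, Refines (cons c α) β ↔ Refines α β') : firstCoeff c (F β) = F β' := by
  classical
  rw [F_eq_sum, F_eq_sum, map_sum]
  simp only [firstCoeff_M hc]
  rw [← Finset.sum_filter]
  refine Finset.sum_nbij' (deleteCol 0) (cons c) ?_ ?_ ?_ ?_ ?_
  · intro α hα
    simp only [Finset.mem_filter, Set.Finite.mem_toFinset, Set.mem_ofPred_eq] at hα ⊢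
    obtain ⟨hα, rfl⟩ := hα
    rwa [← h, cons_deleteCol]
  · intro α hα
    simp only [Finset.mem_filter, Set.Finite.mem_toFinset, Set.mem_ofPred_eq] at hα ⊢
    exact ⟨(h α).2 hα, by simp⟩
  · intro α hα
    simp only [Finset.mem_filter] at hα
    rw [hα.2, cons_deleteCol]
  · intro α _
    rw [deleteCol_cons]
  · intro α _
    rfl

theorem firstCoeff_F_eq_zero {β : GBicomp} {c : ℕ × ℕ} (hc : c ≠ 0)
    (h : ∀ α, ¬ Refines (cons c α) β) : firstCoeff c (F β) = 0 := by
  rw [F_eq_sum, map_sum]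
  refine Finset.sum_eq_zero fun α hα => ?_
  simp only [Set.Finite.mem_toFinset, Set.mem_ofPred_eq] at hα
  rw [firstCoeff_M hc, if_neg]
  rintro rfl
  exact h (deleteCol 0 α) (by rwa [cons_deleteCol])

theorem firstCoeff_zero_F {β : GBicomp} (hβ : IsBicomp β) (h0 : β ≠ 0) :
    firstCoeff 0 (F β) = F β := by
  rw [F_eq_sum, map_sum]
  refine Finset.sum_congr rfl fun α hα => ?_
  simp only [Set.Finite.mem_toFinset, Set.mem_ofPred_eq] at hα
  refine firstCoeff_zero_M ((refines_isBicomp hα hβ).zero_ne ?_)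
  rintro rfl
  exact h0 (size_eq_zero (refines_size hα).symm)

open Classical in
/-- The series `F_β` sums the monomials `w₁(i₁) w₂(i₂) ⋯` with `i₁ ≤ i₂ ≤ ⋯`, where the word `w`
joins the words `x^a y^b` of the columns of `β`, the letter `wₖ` stands for `x` or `y`, and
`iₖ < iₖ₊₁` between different columns. So `x₀` and `y₀` come from a prefix of the first column. -/
theorem firstCoeff_F {β : GBicomp} (hβ : IsBicomp β) (h0 : β ≠ 0) (c : ℕ × ℕ) :
    firstCoeff c (F β) = if c = β 0 then F (deleteCol 0 β) else
      if Pre c (β 0) then F (cons (β 0 - c) (deleteCol 0 β)) else 0 := by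
  have hb := hβ.zero_ne h0
  split_ifs with h1 h2
  · subst h1
    refine firstCoeff_F_eq hb fun α => ?_
    conv_lhs => rw [← cons_deleteCol β]
    simp only [cons_apply_zero]
    exact refines_cons_self_iff hb hβ.deleteCol
  · by_cases hc : c = 0
    · subst hc
      rw [firstCoeff_zero_F hβ h0, tsub_zero, cons_deleteCol]
    · refine firstCoeff_F_eq hc fun α => ?_
      conv_lhs => rw [← cons_deleteCol β]
      rw [refines_cons_iff hb hc h1 hβ.deleteCol]
      exact and_iff_right h2
  · have hc : c ≠ 0 := by
      rintro rfl
      exact h2 ⟨Nat.zero_le _, Nat.zero_le _, Or.inr rfl⟩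
    refine firstCoeff_F_eq_zero hc fun α h => h2 ?_
    rw [← cons_deleteCol β, refines_cons_iff hb hc h1 hβ.deleteCol] at h
    exact h.1

/-! ### Leading monomials of the series `G` -/

/-- The lexicographic order on columns. -/
def ColLex (c d : ℕ × ℕ) : Prop := c.1 < d.1 ∨ (c.1 = d.1 ∧ c.2 < d.2)

theorem ColLex.not_pre {c d : ℕ × ℕ} (h : ColLex c d) : ¬ Pre d c := by
  unfold ColLex at h
  unfold Pre
  omega

theorem ColLex.ne {c d : ℕ × ℕ} (h : ColLex c d) : d ≠ c := by
  rintro rfl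
  unfold ColLex at h
  omega

/-- The part of `G_ε` with the lexicographically largest exponents in `x₀`, `y₀`: it belongs to
the first column of `ε` and is given by the remaining columns. -/
def Leading (ε : GBicomp) : Prop :=
  firstCoeff (ε 0) (G ε) = G (deleteCol 0 ε) ∧ ∀ c, ColLex (ε 0) c → firstCoeff c (G ε) = 0

open Classical in
theorem Leading.firstCoeff_G {γ : GBicomp} (ht : Tail 1 γ) (h : Leading γ) (c : ℕ × ℕ) :
    firstCoeff c (G γ) = if c = γ 0 then F (deleteCol 0 γ) else
      if Pre c (γ 0) then F (cons (γ 0 - c) (deleteCol 0 γ)) else 0 := by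
  have hd : IsBicomp (DQSym.deleteCol 0 γ) := isBicomp_iff_tail.2 ht.deleteCol
  by_cases h0 : γ 0 = 0
  · rw [h0]
    by_cases hc : c = 0
    · rw [if_pos hc, hc, ← G_of_isBicomp hd, ← h.1, h0]
    · have h1 : ColLex 0 c := by
        have : ¬ (c.1 = 0 ∧ c.2 = 0) := fun h => hc (Prod.ext h.1 h.2)
        simp only [ColLex, Prod.fst_zero, Prod.snd_zero]
        omega
      rw [if_neg hc, if_neg h1.not_pre, h.2 c (by rwa [h0])]
  · have hb : IsBicomp γ := by
      rw [← cons_deleteCol γ]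
      exact isBicomp_cons h0 hd
    rw [G_of_isBicomp hb]
    exact firstCoeff_F hb (fun h => h0 (by rw [h]; rfl)) c

theorem leading_G (ε : GBicomp) : Leading ε := by
  classical
  induction ε using G_induction with
  | hb β hβ =>
    by_cases h0 : β = 0
    · subst h0
      have : deleteCol 0 (0 : GBicomp) = 0 := by ext1 j; simp
      refine ⟨?_, fun c hc => ?_⟩
      · rw [this, G_of_isBicomp hβ, F_zero, firstCoeff_one, Finsupp.zero_apply, if_pos rfl]
      · rw [Finsupp.zero_apply] at hc
        rw [G_of_isBicomp hβ, F_zero, firstCoeff_one, if_neg hc.ne]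
    · refine ⟨?_, fun c hc => ?_⟩
      · rw [G_of_isBicomp hβ, G_of_isBicomp hβ.deleteCol, firstCoeff_F hβ h0, if_pos rfl]
      · rw [G_of_isBicomp hβ, firstCoeff_F hβ h0, if_neg hc.ne, if_neg hc.not_pre]
  | hX i γ ht ih1 ih2 =>
    rcases i with _ | i
    · have hβ : IsBicomp (γ + Finsupp.single 0 (1, 0)) := isBicomp_iff_tail.2 (tail_addX ht)
      have hβ0 : (γ + Finsupp.single 0 (1, 0) : GBicomp) 0 = ((γ 0).1 + 1, (γ 0).2) := by
        rw [addX_apply, if_pos rfl]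
      have hβd : deleteCol 0 (γ + Finsupp.single 0 (1, 0)) = deleteCol 0 γ := by
        ext1 j
        simp
      have hne : (γ + Finsupp.single 0 (1, 0) : GBicomp) ≠ 0 := fun h => by
        rw [h] at hβ0
        simp [Prod.ext_iff] at hβ0
      have h0 : phiX 0 γ 0 = 0 := (phiX_cols 0 γ).1
      have hd : deleteCol 0 (phiX 0 γ) = γ + Finsupp.single 0 (1, 0) := by
        ext1 j
        cases j <;> simp [phiX_apply, addX_apply]
      rw [Leading, h0, hd, G_phiX ht]
      refine ⟨?_, fun c hc => ?_⟩
      · rw [map_sub, firstCoeff_x_zero_mul, if_pos Prod.fst_zero, sub_zero,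
          G_of_isBicomp hβ, firstCoeff_zero_F hβ hne]
      · rw [map_sub, firstCoeff_x_zero_mul, G_of_isBicomp hβ, firstCoeff_F hβ hne, hβ0, hβd]
        have hc0 : ¬ (c.1 = 0 ∧ c.2 = 0) := fun h => hc.ne (Prod.ext h.1 h.2)
        by_cases hc1 : c.1 = 0
        · have e1 : c ≠ ((γ 0).1 + 1, (γ 0).2) := fun h => by
            rw [h] at hc1
            simp at hc1
          have e2 : ¬ Pre c ((γ 0).1 + 1, (γ 0).2) := by simp only [Pre]; omega
          rw [if_pos hc1, if_neg e1, if_neg e2, sub_zero]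
        · have e1 : c = ((γ 0).1 + 1, (γ 0).2) ↔ (c.1 - 1, c.2) = γ 0 := by
            simp only [Prod.ext_iff]
            omega
          have e2 : Pre c ((γ 0).1 + 1, (γ 0).2) ↔ Pre (c.1 - 1, c.2) (γ 0) := by
            simp only [Pre]
            omega
          have e3 : ((γ 0).1 + 1, (γ 0).2) - c = γ 0 - (c.1 - 1, c.2) :=
            Prod.ext (by simp only [Prod.fst_sub]; omega) rfl
          rw [if_neg hc1, ih1.firstCoeff_G ht]
          simp only [e1, e2, e3, sub_self]
    · have h0 : phiX (i + 1) γ 0 = γ 0 := by simp [phiX_apply]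
      have h0' : (γ + Finsupp.single (i + 1) (1, 0) : GBicomp) 0 = γ 0 := by simp
      have hd : deleteCol 0 (phiX (i + 1) γ) = phiX i (deleteCol 0 γ) := by
        ext1 j
        simp only [deleteCol_zero_apply, phiX_apply, add_lt_add_iff_right, add_left_inj,
          Nat.add_sub_cancel]
        split_ifs
        all_goals first | rfl | (congr 1; omega)
      have hd' : deleteCol 0 (γ + Finsupp.single (i + 1) (1, 0)) =
          deleteCol 0 γ + Finsupp.single i (1, 0) := by
        ext1 j
        simp only [deleteCol_zero_apply, addX_apply, add_left_inj]
      rw [Leading, h0, hd, G_phiX ht, G_phiX ht.deleteCol]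
      rw [Leading, h0', hd'] at ih2
      refine ⟨?_, fun c hc => ?_⟩
      · rw [map_sub, firstCoeff_x_succ_mul, ih2.1, ih1.1]
      · rw [map_sub, firstCoeff_x_succ_mul, ih2.2 c hc, ih1.2 c hc, mul_zero, sub_zero]
  | hY i γ ht ha ih1 ih2 =>
    rcases i with _ | i
    · have hβ : IsBicomp (γ + Finsupp.single 0 (0, 1)) := isBicomp_iff_tail.2 (tail_addY ht)
      have hβ0 : (γ + Finsupp.single 0 (0, 1) : GBicomp) 0 = ((γ 0).1, (γ 0).2 + 1) := by
        rw [addY_apply, if_pos rfl]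
      have hβd : deleteCol 0 (γ + Finsupp.single 0 (0, 1)) = deleteCol 0 γ := by
        ext1 j
        simp
      have hne : (γ + Finsupp.single 0 (0, 1) : GBicomp) ≠ 0 := fun h => by
        rw [h] at hβ0
        simp [Prod.ext_iff] at hβ0
      have h0 : phiY₀ 0 γ 0 = 0 := by simp [phiY₀_apply]
      have hd : deleteCol 0 (phiY₀ 0 γ) = γ + Finsupp.single 0 (0, 1) := by
        ext1 j
        cases j <;> simp [phiY₀_apply, addY_apply]
      rw [Leading, h0, hd, G_phiY₀ ht ha]
      refine ⟨?_, fun c hc => ?_⟩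
      · rw [map_sub, firstCoeff_y_zero_mul, if_pos Prod.snd_zero, sub_zero,
          G_of_isBicomp hβ, firstCoeff_zero_F hβ hne]
      · rw [map_sub, firstCoeff_y_zero_mul, G_of_isBicomp hβ, firstCoeff_F hβ hne, hβ0, hβd]
        have hc0 : ¬ (c.1 = 0 ∧ c.2 = 0) := fun h => hc.ne (Prod.ext h.1 h.2)
        by_cases hc1 : c.2 = 0
        · have e1 : c ≠ ((γ 0).1, (γ 0).2 + 1) := fun h => by
            rw [h] at hc1
            simp at hc1
          have e2 : ¬ Pre c ((γ 0).1, (γ 0).2 + 1) := by simp only [Pre]; omega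
          rw [if_pos hc1, if_neg e1, if_neg e2, sub_zero]
        · have e1 : c = ((γ 0).1, (γ 0).2 + 1) ↔ (c.1, c.2 - 1) = γ 0 := by
            simp only [Prod.ext_iff]
            omega
          have e2 : Pre c ((γ 0).1, (γ 0).2 + 1) ↔ Pre (c.1, c.2 - 1) (γ 0) := by
            simp only [Pre]
            omega
          have e3 : ((γ 0).1, (γ 0).2 + 1) - c = γ 0 - (c.1, c.2 - 1) :=
            Prod.ext rfl (by simp only [Prod.snd_sub]; omega)
          rw [if_neg hc1, ih1.firstCoeff_G ht]
          simp only [e1, e2, e3, sub_self]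
    · have h0 : phiY₀ (i + 1) γ 0 = γ 0 := by simp [phiY₀_apply]
      have h0' : (γ + Finsupp.single (i + 1) (0, 1) : GBicomp) 0 = γ 0 := by simp
      have hd : deleteCol 0 (phiY₀ (i + 1) γ) = phiY₀ i (deleteCol 0 γ) := by
        ext1 j
        simp only [deleteCol_zero_apply, phiY₀_apply, add_lt_add_iff_right, add_left_inj,
          Nat.add_sub_cancel]
        split_ifs
        all_goals first | rfl | (congr 1; omega)
      have hd' : deleteCol 0 (γ + Finsupp.single (i + 1) (0, 1)) =
          deleteCol 0 γ + Finsupp.single i (0, 1) := by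
        ext1 j
        simp only [deleteCol_zero_apply, addY_apply, add_left_inj]
      rw [Leading, h0, hd, G_phiY₀ ht ha, G_phiY₀ ht.deleteCol (by simpa using ha)]
      rw [Leading, h0', hd'] at ih2
      refine ⟨?_, fun c hc => ?_⟩
      · rw [map_sub, firstCoeff_y_succ_mul, ih2.1, ih1.1]
      · rw [map_sub, firstCoeff_y_succ_mul, ih2.2 c hc, ih1.2 c hc, mul_zero, sub_zero]

theorem deleteCol_zero_zero : deleteCol 0 (0 : GBicomp) = 0 := by
  ext1 j
  simp

theorem len_pos {γ : GBicomp} (h : γ ≠ 0) : 0 < len γ := by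
  obtain ⟨j, hj⟩ := Finsupp.ne_iff.1 h
  exact (Nat.zero_le j).trans_lt (lt_len hj)

theorem G_ne_zero (γ : GBicomp) : G γ ≠ 0 := by
  induction hn : len γ using Nat.strong_induction_on generalizing γ with
  | _ n ih =>
    subst hn
    by_cases h : γ = 0
    · subst h
      rw [G_of_isBicomp isBicomp_zero, F_zero]
      exact one_ne_zero
    · intro h0
      have := (leading_G γ).1
      rw [h0, map_zero] at this
      exact ih _ (len_deleteCol (len_pos h)) _ rfl this.symm

/-- By `leading_G`, the lexicographically largest monomial of `G_γ` is `X^γ`. -/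
theorem G_injective : Function.Injective G := by
  intro γ δ h
  induction hn : len γ + len δ using Nat.strong_induction_on generalizing γ δ with
  | _ n ih =>
    subst hn
    have hle : ∀ ε : GBicomp, len (deleteCol 0 ε) ≤ len ε := fun ε => by
      by_cases h : ε = 0
      · rw [h, deleteCol_zero_zero]
      · exact (len_deleteCol (len_pos h)).le
    have hlex : ∀ {γ δ : GBicomp}, G γ = G δ → ¬ ColLex (γ 0) (δ 0) := fun {γ δ} h hl => by
      refine G_ne_zero (deleteCol 0 δ) ?_
      rw [← (leading_G δ).1, ← h, (leading_G γ).2 _ hl]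
    have h0 : γ 0 = δ 0 := by
      have h1 := hlex h
      have h2 := hlex h.symm
      unfold ColLex at h1 h2
      exact Prod.ext (by omega) (by omega)
    have h1 : G (deleteCol 0 γ) = G (deleteCol 0 δ) := by
      rw [← (leading_G γ).1, ← (leading_G δ).1, h, h0]
    by_cases hγ : γ = 0
    · by_cases hδ : δ = 0
      · rw [hγ, hδ]
      · have := ih _ (add_lt_add_of_le_of_lt (hle γ) (len_deleteCol (len_pos hδ))) h1 rfl
        rw [← cons_deleteCol γ, ← cons_deleteCol δ, h0, this]
    · have := ih _ (add_lt_add_of_lt_of_le (len_deleteCol (len_pos hγ)) (hle δ)) h1 rfl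
      rw [← cons_deleteCol γ, ← cons_deleteCol δ, h0, this]

/-! ### Evaluating quasi-symmetric functions on finite lists -/

/-- The monomial `z₁^{c₁} z₂^{c₂}`. -/
def colEval (c : ℕ × ℕ) (z : ℂ × ℂ) : ℂ := z.1 ^ c.1 * z.2 ^ c.2

/-- The value of `M_u` on a finite list of points: the sum of
`u₁(z_{i₁}) u₂(z_{i₂}) ⋯` over `i₁ < i₂ < ⋯`, where `u` is the list of columns. -/
def listEval : List (ℕ × ℕ) → List (ℂ × ℂ) → ℂ
  | [], _ => 1
  | _ :: _, [] => 0
  | c :: u, z :: l => listEval (c :: u) l + colEval c z * listEval u l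

/-- The sum of all entries of a list of columns. -/
def listSize (u : List (ℕ × ℕ)) : ℕ := (u.map fun c => c.1 + c.2).sum

theorem listEval_nil_left (l : List (ℂ × ℂ)) : listEval [] l = 1 := by cases l <;> rfl

theorem listEval_nil {u : List (ℕ × ℕ)} (h : u ≠ []) : listEval u [] = 0 := by
  cases u with
  | nil => exact absurd rfl h
  | cons c u => rfl

theorem listEval_cons (c : ℕ × ℕ) (u : List (ℕ × ℕ)) (z : ℂ × ℂ) (l : List (ℂ × ℂ)) :
    listEval (c :: u) (z :: l) = listEval (c :: u) l + colEval c z * listEval u l := rfl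

theorem listSize_cons (c : ℕ × ℕ) (u : List (ℕ × ℕ)) :
    listSize (c :: u) = c.1 + c.2 + listSize u := by simp [listSize]

theorem listSize_append (u v : List (ℕ × ℕ)) :
    listSize (u ++ v) = listSize u + listSize v := by simp [listSize]

theorem listEval_append (u : List (ℕ × ℕ)) (l r : List (ℂ × ℂ)) :
    listEval u (l ++ r) =
      ∑ i ∈ Finset.range (u.length + 1), listEval (u.take i) l * listEval (u.drop i) r := by
  induction l generalizing u with
  | nil =>
    rw [Finset.sum_eq_single 0]
    · simp [listEval_nil_left]
    · intro i hi h0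
      rw [listEval_nil, zero_mul]
      intro h
      rw [List.take_eq_nil_iff] at h
      rcases h with h | h
      · exact h0 h
      · subst h
        simp only [List.length_nil, zero_add, Finset.range_one, Finset.mem_singleton] at hi
        exact h0 hi
    · intro h
      simp at h
  | cons z l ih =>
    cases u with
    | nil => simp [listEval_nil_left]
    | cons c u =>
      rw [List.cons_append, listEval_cons, ih, ih, List.length_cons, Finset.sum_range_succ',
        Finset.sum_range_succ' (n := u.length + 1), Finset.mul_sum]
      simp only [List.take_succ_cons, List.drop_succ_cons, List.take_zero, List.drop_zero,
        listEval_nil_left, listEval_cons, add_mul, Finset.sum_add_distrib, mul_assoc]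
      ring

theorem listEval_concat (u : List (ℕ × ℕ)) (c : ℕ × ℕ) (l : List (ℂ × ℂ)) (z : ℂ × ℂ) :
    listEval (u ++ [c]) (l ++ [z]) = listEval (u ++ [c]) l + listEval u l * colEval c z := by
  induction l generalizing u with
  | nil =>
    cases u with
    | nil => simp [listEval]
    | cons d u =>
      rw [List.cons_append, List.nil_append, listEval_cons, listEval_nil (u := u ++ [c]) (by simp),
        listEval_nil (u := d :: u) (by simp), mul_zero, zero_mul]
  | cons w l ih =>
    cases u with
    | nil =>
      have := ih []
      simp only [List.nil_append, List.cons_append, listEval_cons, listEval_nil_left] at this ⊢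
      rw [this]
      ring
    | cons d u =>
      have := ih (d :: u)
      simp only [List.cons_append, listEval_cons] at this ⊢
      rw [this, ih u]
      ring

theorem listEval_scale (ζ : ℂ) (u : List (ℕ × ℕ)) (l : List (ℂ × ℂ)) :
    listEval u (l.map fun z => (ζ * z.1, ζ * z.2)) = ζ ^ listSize u * listEval u l := by
  induction l generalizing u with
  | nil =>
    cases u with
    | nil => simp [listEval, listSize]
    | cons c u => simp [listEval]
  | cons z l ih =>
    cases u with
    | nil => simp [listEval_nil_left, listSize]
    | cons c u =>
      rw [List.map_cons, listEval_cons, listEval_cons, ih, ih, listSize_cons]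
      simp only [colEval, mul_pow, pow_add]
      ring

/-- The points `ζ t, ζ² t, …, ζᵈ t`. -/
def orbit (ζ : ℂ) (d : ℕ) (t : ℂ × ℂ) : List (ℂ × ℂ) :=
  (List.range d).map fun i => (ζ ^ (i + 1) * t.1, ζ ^ (i + 1) * t.2)

theorem map_scale_orbit {ζ : ℂ} {d : ℕ} (h : ζ ^ (d + 1) = 1) (t : ℂ × ℂ) :
    (t :: orbit ζ d t).map (fun z => (ζ * z.1, ζ * z.2)) = orbit ζ d t ++ [t] := by
  have h1 : (t :: orbit ζ d t).map (fun z => (ζ * z.1, ζ * z.2)) =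
      (List.range (d + 1)).map fun i => (ζ ^ (i + 1) * t.1, ζ ^ (i + 1) * t.2) := by
    rw [List.range_succ_eq_map, orbit]
    simp only [List.map_cons, List.map_map, zero_add, pow_one]
    congr 2
    funext i
    simp only [Function.comp, pow_succ]
    exact Prod.ext (by ring) (by ring)
  rw [h1, List.range_succ, List.map_append, orbit, List.map_singleton, h, one_mul, one_mul]

/-- If `ζ` is a primitive root of unity of order `d + 1`, then `M_u` vanishes on
`t, ζ t, …, ζᵈ t` for `1 ≤ |u| ≤ d`: by induction on the length, rotating the list does not change
the value of `M_u`, but it amounts to multiplying all points by `ζ`. -/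
theorem listEval_orbit {ζ : ℂ} {d : ℕ} (hζ : IsPrimitiveRoot ζ (d + 1)) (t : ℂ × ℂ)
    {u : List (ℕ × ℕ)} (hu : u ≠ []) (hu0 : ∀ c ∈ u, c ≠ 0) (hd : listSize u ≤ d) :
    listEval u (t :: orbit ζ d t) = 0 := by
  induction hn : u.length using Nat.strong_induction_on generalizing u with
  | _ n ih =>
  subst hn
  -- for `v` shorter than `u`, the value is zero with `t` included, so that it can be computed
  -- without `t` by splitting off the columns one by one
  have hinv : ∀ v : List (ℕ × ℕ), v.length < u.length → (∀ c ∈ v, c ≠ 0) → listSize v ≤ d →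
      listEval v (orbit ζ d t) = (-1) ^ v.length * (v.map fun c => colEval c t).prod := by
    intro v
    induction v with
    | nil => simp [listEval_nil_left]
    | cons c v ihv =>
      intro h1 h2 h3
      have h4 := ih _ h1 (u := c :: v) (by simp) h2 h3 rfl
      rw [listEval_cons, ihv (by rw [List.length_cons] at h1; omega)
        (fun e he => h2 e (List.mem_cons_of_mem _ he)) (by rw [listSize_cons] at h3; omega)] at h4
      rw [eq_neg_of_add_eq_zero_left h4, List.length_cons, List.map_cons, List.prod_cons]
      ring
  have hrot : listEval u (orbit ζ d t ++ [t]) = listEval u (t :: orbit ζ d t) := by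
    obtain ⟨c, w, rfl⟩ := List.exists_cons_of_ne_nil hu
    obtain ⟨w', e, he⟩ : ∃ w' e, c :: w = w' ++ [e] :=
      ⟨_, _, (List.dropLast_append_getLast hu).symm⟩
    have hlen : w.length = w'.length := by
      have := congrArg List.length he
      simpa using this
    have hw := hinv w (by simp) (fun b hb => hu0 b (List.mem_cons_of_mem _ hb))
      (by rw [listSize_cons] at hd; omega)
    have hw' := hinv w' (by rw [List.length_cons]; omega)
      (fun b hb => hu0 b (by rw [he]; exact List.mem_append_left _ hb))
      (by rw [he, listSize_append] at hd; omega)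
    have hprod := congrArg (fun v : List (ℕ × ℕ) => (v.map fun c => colEval c t).prod) he
    simp only [List.map_cons, List.prod_cons, List.map_append, List.prod_append, List.map_nil,
      List.prod_nil, mul_one] at hprod
    rw [listEval_cons, hw, he, listEval_concat, hw', hlen, mul_assoc, ← hprod]
    ring
  have hs := listEval_scale ζ u (t :: orbit ζ d t)
  rw [map_scale_orbit hζ.pow_eq_one, hrot] at hs
  have hpos : 0 < listSize u := by
    obtain ⟨c, w, rfl⟩ := List.exists_cons_of_ne_nil hu
    have hc := hu0 c List.mem_cons_self
    rw [listSize_cons]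
    by_contra! h
    exact hc (Prod.ext (by simp only [Prod.fst_zero]; omega) (by simp only [Prod.snd_zero]; omega))
  have hne : ζ ^ listSize u ≠ 1 := hζ.pow_ne_one_of_pos_of_lt hpos.ne' (by omega)
  have : (1 - ζ ^ listSize u) * listEval u (t :: orbit ζ d t) = 0 := by
    linear_combination hs
  exact (mul_eq_zero.1 this).resolve_left (sub_ne_zero.2 hne.symm)

/-- Nested orbits: the list starts with `ts`, and each point is cancelled by its orbit. -/
def nest (ζ : ℂ) (d : ℕ) : List (ℂ × ℂ) → List (ℂ × ℂ)
  | [] => []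
  | t :: ts => t :: (nest ζ d ts ++ orbit ζ d t)

/-- By `listEval_append` and induction, the inner nest has no effect on the value of `M_u` for
`|u| ≤ d`, which leaves the case of one orbit. -/
theorem listEval_nest {ζ : ℂ} {d : ℕ} (hζ : IsPrimitiveRoot ζ (d + 1)) (ts : List (ℂ × ℂ))
    {u : List (ℕ × ℕ)} (hu : u ≠ []) (hu0 : ∀ c ∈ u, c ≠ 0) (hd : listSize u ≤ d) :
    listEval u (nest ζ d ts) = 0 := by
  induction ts generalizing u with
  | nil => exact listEval_nil hu
  | cons t ts ih =>
    have happ : ∀ v : List (ℕ × ℕ), (∀ c ∈ v, c ≠ 0) → listSize v ≤ d →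
        listEval v (nest ζ d ts ++ orbit ζ d t) = listEval v (orbit ζ d t) := by
      intro v hv0 hv
      rw [listEval_append, Finset.sum_eq_single 0]
      · simp [listEval_nil_left]
      · intro i hi h0
        rw [ih, zero_mul]
        · intro h
          rw [List.take_eq_nil_iff] at h
          rcases h with h | h
          · exact h0 h
          · subst h
            simp only [List.length_nil, zero_add, Finset.range_one, Finset.mem_singleton] at hi
            exact h0 hi
        · exact fun c hc => hv0 c (List.mem_of_mem_take hc)
        · have := listSize_append (v.take i) (v.drop i)
          rw [List.take_append_drop] at this
          omega
      · intro h
        simp at h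
    obtain ⟨c, w, rfl⟩ := List.exists_cons_of_ne_nil hu
    rw [nest, listEval_cons, happ _ hu0 hd,
      happ w (fun b hb => hu0 b (List.mem_cons_of_mem _ hb)) (by rw [listSize_cons] at hd; omega),
      ← listEval_cons]
    exact listEval_orbit hζ t hu hu0 hd

theorem nest_getD (ζ : ℂ) (d : ℕ) (ts : List (ℂ × ℂ)) {j : ℕ} (hj : j < ts.length) :
    (nest ζ d ts).getD j 0 = ts.getD j 0 ∧ j < (nest ζ d ts).length := by
  induction ts generalizing j with
  | nil => exact absurd hj (Nat.not_lt_zero j)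
  | cons t ts ih =>
    cases j with
    | zero => simp [nest]
    | succ j =>
      obtain ⟨h1, h2⟩ := ih (Nat.lt_of_succ_lt_succ hj)
      constructor
      · rw [nest, List.getD_cons_succ, List.getD_cons_succ, List.getD_append _ _ _ _ h2, h1]
      · rw [nest, List.length_cons, List.length_append]
        omega

/-! ### Evaluation of power series -/

/-- The embedding of variables that raises all indices by one. -/
def shiftEmb : ℕ ⊕ ℕ ↪ ℕ ⊕ ℕ :=
  ⟨Sum.map Nat.succ Nat.succ, Function.Injective.sumMap Nat.succ_injective Nat.succ_injective⟩

/-- The substitution `x j ↦ x (j + 1)`, `y j ↦ y (j + 1)`. -/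
def shift : R →ₐ[ℚ] R := MvPowerSeries.rename shiftEmb

theorem firstCoeff_shift (c : ℕ × ℕ) (f : R) :
    firstCoeff c (shift f) = if c = 0 then f else 0 := by
  refine series_ext fun δ => ?_
  rw [coeff_firstCoeff]
  split_ifs with hc
  · subst hc
    have : expo (cons 0 δ) = Finsupp.embDomain shiftEmb (expo δ) := by
      rw [Finsupp.embDomain_eq_mapDomain, expo_cons]
      simp [shiftEmb]
    rw [this, shift, MvPowerSeries.coeff_embDomain_rename]
  · rw [shift, MvPowerSeries.coeff_rename_eq_zero, map_zero]
    rintro ⟨m, hm⟩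
    refine hc (Prod.ext ?_ ?_)
    · have h1 := expo_inl (cons c δ) 0
      rw [← hm, cons_apply_zero, Finsupp.mapDomain_of_notMem_range] at h1
      · exact h1.symm
      · rintro ⟨a | a, h⟩ <;> simp [shiftEmb] at h
    · have h1 := expo_inr (cons c δ) 0
      rw [← hm, cons_apply_zero, Finsupp.mapDomain_of_notMem_range] at h1
      · exact h1.symm
      · rintro ⟨a | a, h⟩ <;> simp [shiftEmb] at h

theorem firstCoeff_ext {f g : R} (h : ∀ c, firstCoeff c f = firstCoeff c g) : f = g := by
  refine series_ext fun δ => ?_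
  rw [← cons_deleteCol δ, ← coeff_firstCoeff, ← coeff_firstCoeff, h]

theorem firstCoeff_monomial_mul_shift (a b : ℕ) (c : ℕ × ℕ) (f : R) :
    firstCoeff c (x 0 ^ a * (y 0 ^ b * shift f)) = if c = (a, b) then f else 0 := by
  induction a generalizing c with
  | zero =>
    rw [pow_zero, one_mul]
    induction b generalizing c with
    | zero =>
      rw [pow_zero, one_mul, firstCoeff_shift]
      rfl
    | succ b ih =>
      rw [pow_succ', mul_assoc, firstCoeff_y_zero_mul]
      by_cases hc : c.2 = 0
      · rw [if_pos hc, if_neg]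
        rintro rfl
        simp at hc
      · rw [if_neg hc, ih]
        congr 1
        simp only [Prod.ext_iff, eq_iff_iff]
        omega
  | succ a ih =>
    rw [pow_succ', mul_assoc, firstCoeff_x_zero_mul]
    by_cases hc : c.1 = 0
    · rw [if_pos hc, if_neg]
      rintro rfl
      simp at hc
    · rw [if_neg hc, ih]
      congr 1
      simp only [Prod.ext_iff, eq_iff_iff]
      omega

theorem M_cons {c : ℕ × ℕ} (hc : c ≠ 0) (α : GBicomp) :
    M (cons c α) = shift (M (cons c α)) + x 0 ^ c.1 * (y 0 ^ c.2 * shift (M α)) := by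
  refine firstCoeff_ext fun d => ?_
  rw [map_add, firstCoeff_shift, firstCoeff_monomial_mul_shift]
  by_cases hd : d = 0
  · subst hd
    rw [firstCoeff_zero_M (by simpa using hc), if_pos rfl, if_neg (fun h => hc h.symm), add_zero]
  · rw [firstCoeff_M hd, cons_apply_zero, deleteCol_cons, if_neg hd, zero_add]

/-- The values of the variables given by a finite list of points; all further variables are
set to `0`. -/
def point (l : List (ℂ × ℂ)) : ℕ ⊕ ℕ → ℂ :=
  Sum.elim (fun j => (l.getD j 0).1) fun j => (l.getD j 0).2

theorem hasSubst_point (l : List (ℂ × ℂ)) :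
    MvPowerSeries.HasSubst fun s => (PowerSeries.C (point l s) * PowerSeries.X :
      MvPowerSeries Unit ℂ) where
  const_coeff s := by
    have : PowerSeries.constantCoeff (PowerSeries.C (point l s) * PowerSeries.X) = 0 := by simp
    exact (show MvPowerSeries.constantCoeff (PowerSeries.C (point l s) * PowerSeries.X) = 0
      from this) ▸ IsNilpotent.zero
  coeff_zero d := by
    have hfin : (Sum.inl '' Set.Iio l.length ∪ Sum.inr '' Set.Iio l.length :
        Set (ℕ ⊕ ℕ)).Finite :=
      ((Set.finite_Iio _).image _).union ((Set.finite_Iio _).image _)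
    refine hfin.subset fun s hs => ?_
    by_contra hc
    have h0 : point l s = 0 := by
      rcases s with j | j <;> simp only [Set.mem_union, Set.mem_image, Set.mem_Iio, not_or,
        not_exists, not_and] at hc
      · have : l.length ≤ j := by
          by_contra! h
          exact hc.1 j h rfl
        exact congrArg Prod.fst (List.getD_eq_default l 0 this)
      · have : l.length ≤ j := by
          by_contra! h
          exact hc.2 j h rfl
        exact congrArg Prod.snd (List.getD_eq_default l 0 this)
    refine hs ?_
    rw [h0, map_zero, zero_mul, map_zero]

/-- The evaluation of power series at the points `l`, graded by a variable `T`: the homomorphism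
with `x j ↦ a T`, `y j ↦ b T` if the `j`-th point is `(a, b)`. -/
def evalT (l : List (ℂ × ℂ)) : R →ₐ[ℚ] PowerSeries ℂ :=
  MvPowerSeries.substAlgHom (hasSubst_point l)

theorem evalT_X (l : List (ℂ × ℂ)) (s : ℕ ⊕ ℕ) :
    evalT l (MvPowerSeries.X s) = PowerSeries.C (point l s) * PowerSeries.X :=
  MvPowerSeries.substAlgHom_X (hasSubst_point l) s

theorem evalT_cons_shift (z : ℂ × ℂ) (l : List (ℂ × ℂ)) (f : R) :
    evalT (z :: l) (shift f) = evalT l f := by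
  rw [evalT, evalT, shift, MvPowerSeries.rename_eq_subst, MvPowerSeries.substAlgHom_apply,
    MvPowerSeries.subst_comp_subst_apply (MvPowerSeries.HasSubst.X_comp shiftEmb)
      (hasSubst_point (z :: l)), MvPowerSeries.substAlgHom_apply]
  congr 1
  funext s
  rw [Function.comp_apply, MvPowerSeries.subst_X (hasSubst_point (z :: l))]
  rcases s with j | j <;> rfl

/-- The bicomposition with the given list of columns. -/
def ofList (u : List (ℕ × ℕ)) : GBicomp := u.foldr cons 0

theorem IsBicomp.exists_ofList {α : GBicomp} (h : IsBicomp α) :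
    ∃ u : List (ℕ × ℕ), (∀ c ∈ u, c ≠ 0) ∧ ofList u = α := by
  induction hn : len α using Nat.strong_induction_on generalizing α with
  | _ n ih =>
    subst hn
    by_cases h0 : α = 0
    · exact ⟨[], by simp, h0.symm⟩
    · obtain ⟨u, hu, he⟩ := ih _ (len_deleteCol (len_pos h0)) h.deleteCol rfl
      refine ⟨α 0 :: u, ?_, ?_⟩
      · intro c hc
        rcases List.mem_cons.1 hc with rfl | hc
        · exact h.zero_ne h0
        · exact hu c hc
      · rw [ofList, List.foldr_cons, ← ofList, he, cons_deleteCol]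

theorem coeff_zero_M {α : GBicomp} (h : α ≠ 0) : MvPowerSeries.constantCoeff (M α) = 0 := by
  classical
  rw [← MvPowerSeries.coeff_zero_eq_constantCoeff_apply, show (0 : ℕ ⊕ ℕ →₀ ℕ) = expo 0 from rfl,
    coeff_M, if_neg]
  rintro ⟨i, hi, h'⟩
  exact h (Finsupp.mapDomain_injective hi.injective (by rw [← h', Finsupp.mapDomain_zero]))

theorem evalT_nil (f : R) :
    evalT [] f = PowerSeries.C ((MvPowerSeries.constantCoeff f : ℚ) : ℂ) := by
  have h : (fun s => (PowerSeries.C (point [] s) * PowerSeries.X : MvPowerSeries Unit ℂ)) = 0 := by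
    funext s
    have : point [] s = 0 := by rcases s with j | j <;> simp [point]
    rw [this, map_zero, zero_mul]
    rfl
  rw [evalT, MvPowerSeries.substAlgHom_apply, h, MvPowerSeries.subst_zero_eq_C_constantCoeff,
    MvPowerSeries.map_C]
  rfl

theorem evalT_M {u : List (ℕ × ℕ)} (hu : ∀ c ∈ u, c ≠ 0) (l : List (ℂ × ℂ)) :
    evalT l (M (ofList u)) = PowerSeries.C (listEval u l) * PowerSeries.X ^ listSize u := by
  induction l generalizing u with
  | nil =>
    cases u with
    | nil =>
      rw [show ofList [] = 0 from rfl, M_zero, map_one, listEval_nil_left]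
      simp [listSize]
    | cons c u =>
      rw [evalT_nil, coeff_zero_M, listEval_nil (by simp)]
      · simp
      · intro h
        have := cons_apply_zero c (ofList u)
        rw [show cons c (ofList u) = ofList (c :: u) from rfl, h] at this
        exact hu c List.mem_cons_self this.symm
  | cons z l ih =>
    cases u with
    | nil =>
      rw [show ofList [] = 0 from rfl, M_zero, map_one, listEval_nil_left]
      simp [listSize]
    | cons c u =>
      have h1 := ih hu
      have h2 := ih fun b hb => hu b (List.mem_cons_of_mem _ hb)
      rw [show ofList (c :: u) = cons c (ofList u) from rfl] at h1 ⊢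
      rw [M_cons (hu c List.mem_cons_self), map_add, map_mul, map_mul, evalT_cons_shift,
        evalT_cons_shift, map_pow, map_pow, h1, h2, x, y, evalT_X, evalT_X, listEval_cons,
        listSize_cons]
      have e1 : point (z :: l) (Sum.inl 0) = z.1 := rfl
      have e2 : point (z :: l) (Sum.inr 0) = z.2 := rfl
      rw [e1, e2, map_add, map_mul, colEval, map_mul, map_pow, map_pow]
      ring

/-! ### Polynomials in the ideal `I` -/

open scoped MvPowerSeries.WithPiTopology in
theorem isClosed_coeff_subst {τ S : Type*} [CommRing S] [Algebra ℚ S]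
    {a : ℕ ⊕ ℕ → MvPowerSeries τ S} (ha : MvPowerSeries.HasSubst a) (e : τ →₀ ℕ) :
    IsClosed {f : R | MvPowerSeries.coeff e (MvPowerSeries.subst a f) = 0} := by
  let : UniformSpace ℚ := ⊥
  let : UniformSpace S := ⊥
  have : DiscreteTopology S := ⟨rfl⟩
  have h1 := MvPowerSeries.continuous_subst (R := ℚ) ha
  have h2 := (MvPowerSeries.WithPiTopology.continuous_coeff S e).comp h1
  exact @IsClosed.preimage _ _ _ _ _ h2 {0} (isClosed_discrete _)

/-- The evaluation at nested orbits kills the ideal `I` up to degree `d`. -/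
theorem coeff_evalT_of_mem_I {ζ : ℂ} {d : ℕ} (hζ : IsPrimitiveRoot ζ (d + 1))
    (ts : List (ℂ × ℂ)) {f : R} (hf : f ∈ I) {e : ℕ} (he : e ≤ d) :
    PowerSeries.coeff e (evalT (nest ζ d ts) f) = 0 := by
  set l := nest ζ d ts
  set 𝔞 : Ideal R := Ideal.comap (evalT l) (Ideal.span {(PowerSeries.X : PowerSeries ℂ) ^ (d + 1)})
    with h𝔞
  have hM : ∀ f ∈ diagQSym, (PowerSeries.X : PowerSeries ℂ) ^ (d + 1) ∣
      evalT l f - PowerSeries.C ((MvPowerSeries.constantCoeff f : ℚ) : ℂ) := by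
    intro f hf
    induction hf using Submodule.span_induction with
    | mem f hf =>
      obtain ⟨α, hα, rfl⟩ := hf
      obtain ⟨u, hu, rfl⟩ := hα.exists_ofList
      by_cases hu0 : u = []
      · subst hu0
        rw [show ofList [] = 0 from rfl, M_zero, map_one, map_one]
        simp
      · have hne : ofList u ≠ 0 := by
          obtain ⟨c, w, rfl⟩ := List.exists_cons_of_ne_nil hu0
          intro h
          have := cons_apply_zero c (ofList w)
          rw [show cons c (ofList w) = ofList (c :: w) from rfl, h] at this
          exact hu c List.mem_cons_self this.symm
        rw [evalT_M hu, coeff_zero_M hne]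
        by_cases hd : listSize u ≤ d
        · rw [listEval_nest hζ ts hu0 hu hd]
          simp
        · rw [Rat.cast_zero, map_zero, sub_zero]
          exact (pow_dvd_pow _ (by omega)).mul_left _
    | zero => simp
    | add f g _ _ hf hg =>
      have := dvd_add hf hg
      rw [map_add, map_add, Rat.cast_add, map_add]
      convert this using 1
      ring
    | smul c f _ hf =>
      have e1 : evalT l (c • f) = PowerSeries.C (c : ℂ) * evalT l f := by
        rw [map_smul, Algebra.smul_def, PowerSeries.algebraMap_apply]
        rfl
      have e2 : MvPowerSeries.constantCoeff (c • f) = c * MvPowerSeries.constantCoeff f := rfl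
      rw [e1, e2, Rat.cast_mul, map_mul, ← mul_sub]
      exact hf.mul_left _
  have hle : Ideal.span {f | f ∈ diagQSym ∧ MvPowerSeries.constantCoeff f = 0} ≤ 𝔞 := by
    refine Ideal.span_le.2 ?_
    rintro f ⟨hf, h0⟩
    have := hM f hf
    rw [h0, Rat.cast_zero, map_zero, sub_zero] at this
    exact Ideal.mem_comap.2 (Ideal.mem_span_singleton.2 this)
  have hclosed : IsClosed {f : R | PowerSeries.coeff e (evalT l f) = 0} := by
    simp only [evalT, MvPowerSeries.substAlgHom_apply]
    exact isClosed_coeff_subst (hasSubst_point l) (Finsupp.single () e)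
  have hsub : {f : R | f ∈ 𝔞} ⊆ {f : R | PowerSeries.coeff e (evalT l f) = 0} := by
    intro f hf
    have h1 : (PowerSeries.X : PowerSeries ℂ) ^ (d + 1) ∣ evalT l f :=
      Ideal.mem_span_singleton.1 (Ideal.mem_comap.1 hf)
    exact PowerSeries.X_pow_dvd_iff.1 h1 e (by omega)
  have hcl : f ∈ closure {f : R | f ∈ Ideal.span {f | f ∈ diagQSym ∧
      MvPowerSeries.constantCoeff f = 0}} := hf
  exact closure_minimal ((fun f hf => hsub (hle hf))) hclosed hcl

theorem exists_point_eq {ζ : ℂ} (d m : ℕ) (s : ℕ ⊕ ℕ → ℂ) : ∃ ts : List (ℂ × ℂ),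
    ∀ j < m, point (nest ζ d ts) (Sum.inl j) = s (Sum.inl j) ∧
      point (nest ζ d ts) (Sum.inr j) = s (Sum.inr j) := by
  refine ⟨(List.range m).map fun j => (s (Sum.inl j), s (Sum.inr j)), fun j hj => ?_⟩
  have h := (nest_getD ζ d ((List.range m).map fun j => (s (Sum.inl j), s (Sum.inr j)))
    (j := j) (by simpa using hj)).1
  have h' : ((List.range m).map fun j => (s (Sum.inl j), s (Sum.inr j))).getD j 0 =
      (s (Sum.inl j), s (Sum.inr j)) := by
    simp [List.getD_eq_getElem?_getD, hj]
  simp only [point, Sum.elim_inl, Sum.elim_inr]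
  rw [h, h']
  exact ⟨rfl, rfl⟩

/-- The restriction of `evalT` to polynomials, with values in polynomials in `T`. -/
def evalP (l : List (ℂ × ℂ)) : Poly →ₐ[ℚ] Polynomial ℂ :=
  MvPolynomial.aeval fun i => Polynomial.C (point l i) * Polynomial.X

theorem coe_evalP (l : List (ℂ × ℂ)) (p : Poly) :
    (evalP l p : PowerSeries ℂ) = evalT l (p : R) := by
  have h : ((Polynomial.coeToPowerSeries.algHom (R := ℂ) ℂ).restrictScalars ℚ).comp (evalP l) =
      (evalT l).comp (MvPolynomial.coeToMvPowerSeries.algHom ℚ) := by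
    refine MvPolynomial.algHom_ext fun i => ?_
    simp [evalP, evalT_X]
  have := DFunLike.congr_fun h p
  simpa using this

theorem aeval_one_evalP (l : List (ℂ × ℂ)) (p : Poly) :
    Polynomial.eval 1 (evalP l p) = MvPolynomial.aeval (point l) p := by
  have h : ((Polynomial.aeval (R := ℂ) (1 : ℂ)).restrictScalars ℚ).comp (evalP l) =
      MvPolynomial.aeval (point l) := by
    refine MvPolynomial.algHom_ext fun i => ?_
    simp [evalP]
  have := DFunLike.congr_fun h p
  simpa using this

theorem natDegree_evalP_le (l : List (ℂ × ℂ)) (p : Poly) :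
    (evalP l p).natDegree ≤ p.totalDegree := by
  have h : (MvPolynomial.map (algebraMap ℚ ℂ) p).totalDegree ≤ p.totalDegree :=
    Finset.sup_mono (MvPolynomial.support_map_subset _ _)
  have := MvPolynomial.aeval_natDegree_le (R := ℂ) _ h
    (fun i => Polynomial.C (point l i) * Polynomial.X) (n := 1)
    fun i => (Polynomial.natDegree_C_mul_le _ _).trans Polynomial.natDegree_X_le
  rw [MvPolynomial.aeval_map_algebraMap, mul_one] at this
  exact this

/-- Polynomials inject into `R / I`: a polynomial of degree `d` in `I` vanishes at every point,
because the relevant coordinates of the point can be completed to nested orbits of order `d + 1`. -/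
theorem eq_zero_of_mem_I {p : Poly} (hp : (p : R) ∈ I) : p = 0 := by
  set d := p.totalDegree with hd
  have hζ := Complex.isPrimitiveRoot_exp (d + 1) (Nat.succ_ne_zero d)
  set ζ := Complex.exp (2 * Real.pi * Complex.I / ((d + 1 : ℕ) : ℂ))
  obtain ⟨m, hm⟩ : ∃ m : ℕ, ∀ s ∈ p.vars, Sum.elim id id s < m := by
    refine ⟨p.vars.sup (Sum.elim id id) + 1, fun s hs => Nat.lt_succ_of_le ?_⟩
    exact Finset.le_sup (f := Sum.elim id id) hs
  have hval : ∀ s : ℕ ⊕ ℕ → ℂ, MvPolynomial.aeval s p = 0 := by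
    intro s
    obtain ⟨ts, hts⟩ := exists_point_eq (ζ := ζ) d m s
    have hq0 : evalP (nest ζ d ts) p = 0 := by
      ext e
      rw [Polynomial.coeff_zero]
      by_cases he : e ≤ d
      · rw [← Polynomial.coeff_coe, coe_evalP]
        exact coeff_evalT_of_mem_I hζ ts hp he
      · exact Polynomial.coeff_eq_zero_of_natDegree_lt
          ((natDegree_evalP_le _ p).trans_lt (not_le.1 he))
    have h1 : MvPolynomial.aeval (point (nest ζ d ts)) p = 0 := by
      rw [← aeval_one_evalP, hq0, Polynomial.eval_zero]
    rw [← h1]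
    refine MvPolynomial.eval₂Hom_congr' rfl (fun i hi _ => ?_) rfl
    have := hm i hi
    rcases i with j | j
    · exact (hts j this).1.symm
    · exact (hts j this).2.symm
  have hmap : MvPolynomial.map (algebraMap ℚ ℂ) p = 0 := by
    refine MvPolynomial.funext fun s => ?_
    rw [MvPolynomial.eval_map, map_zero]
    exact hval s
  exact MvPolynomial.map_injective _ (algebraMap ℚ ℂ).injective (by rw [hmap, map_zero])

/-! ### The quotient `R / I` -/

theorem F_mem_I {β : GBicomp} (hβ : IsBicomp β) (h0 : β ≠ 0) : F β ∈ I := by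
  refine subset_closure (Ideal.subset_span ?_)
  rw [F_eq_sum]
  constructor
  · refine Submodule.sum_mem _ fun α hα => Submodule.subset_span ?_
    exact ⟨α, refines_isBicomp ((finite_refines β).mem_toFinset.1 hα) hβ, rfl⟩
  · rw [map_sum]
    refine Finset.sum_eq_zero fun α hα => coeff_zero_M ?_
    rintro rfl
    refine h0 (size_eq_zero ?_)
    rw [← refines_size ((finite_refines β).mem_toFinset.1 hα)]
    exact Finsupp.sum_zero_index

/-- The map `ℚ[x, y] → R / I`. -/
def polyMk : Poly →ₐ[ℚ] R ⧸ I :=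
  (Ideal.Quotient.mkₐ ℚ I).comp (MvPolynomial.coeToMvPowerSeries.algHom ℚ)

theorem polyMk_apply (p : Poly) : polyMk p = Ideal.Quotient.mk I (p : R) := by
  simp [polyMk]

theorem polyMk_injective : Function.Injective polyMk := by
  refine (injective_iff_map_eq_zero _).2 fun p hp => eq_zero_of_mem_I ?_
  rwa [polyMk_apply, Ideal.Quotient.eq_zero_iff_mem] at hp

theorem polyMk_X_inl (i : ℕ) :
    polyMk (MvPolynomial.X (Sum.inl i)) = Ideal.Quotient.mk I (x i) := by
  rw [polyMk_apply, MvPolynomial.coe_X, x]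

theorem polyMk_X_inr (i : ℕ) :
    polyMk (MvPolynomial.X (Sum.inr i)) = Ideal.Quotient.mk I (y i) := by
  rw [polyMk_apply, MvPolynomial.coe_X, y]

theorem exists_polyMk_eq (γ : GBicomp) : ∃ p : Poly, polyMk p = Ideal.Quotient.mk I (G γ) := by
  induction γ using G_induction with
  | hb β hβ =>
    rw [G_of_isBicomp hβ]
    by_cases h0 : β = 0
    · exact ⟨1, by rw [h0, F_zero, map_one, map_one]⟩
    · exact ⟨0, by rw [map_zero, Ideal.Quotient.eq_zero_iff_mem.2 (F_mem_I hβ h0)]⟩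
  | hX i γ h h1 h2 =>
    obtain ⟨p, hp⟩ := h1
    obtain ⟨q, hq⟩ := h2
    exact ⟨q - MvPolynomial.X (Sum.inl i) * p, by
      rw [G_phiX h, map_sub, map_sub, map_mul, map_mul, hp, hq, polyMk_X_inl]⟩
  | hY i γ h ha h1 h2 =>
    obtain ⟨p, hp⟩ := h1
    obtain ⟨q, hq⟩ := h2
    exact ⟨q - MvPolynomial.X (Sum.inr i) * p, by
      rw [G_phiY₀ h ha, map_sub, map_sub, map_mul, map_mul, hp, hq, polyMk_X_inr]⟩

/-- The recursion for `G` holds for the polynomials that represent the classes of the `G_γ`,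
because these polynomials are unique. -/
theorem exists_isReduction :
    ∃ ρ, IsReduction ρ ∧ ∀ γ, polyMk (ρ γ) = Ideal.Quotient.mk I (G γ) := by
  choose ρ hρ using exists_polyMk_eq
  refine ⟨ρ, ⟨?_, fun β hβ h0 => ?_, fun i γ h => ?_, fun i γ h ha => ?_⟩, hρ⟩ <;>
    apply polyMk_injective
  · rw [hρ, G_of_isBicomp isBicomp_zero, F_zero, map_one, map_one]
  · rw [hρ, G_of_isBicomp hβ, map_zero, Ideal.Quotient.eq_zero_iff_mem.2 (F_mem_I hβ h0)]
  · rw [map_sub, map_mul, hρ, hρ, hρ, G_phiX h, map_sub, map_mul, polyMk_X_inl]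
  · rw [map_sub, map_mul, hρ, hρ, hρ, G_phiY₀ h ha, map_sub, map_mul, polyMk_X_inr]

/-- The elements of the `G` basis outside of the image of `Φ` are the `G_γ` for which `γ` is the
index of `Φ(X^α F_0)`. -/
theorem A_eq_range : A = Set.range fun α => G (Phi α 0) := by
  ext g
  constructor
  · rintro ⟨⟨γ, rfl⟩, hg⟩
    obtain ⟨α, β, hβ, rfl⟩ := exists_Phi_eq γ
    have h0 : β = 0 := by
      by_contra h0
      exact hg ⟨α, β, hβ, h0, rfl⟩
    exact ⟨α, by rw [h0]⟩
  · rintro ⟨α, rfl⟩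
    refine ⟨⟨_, rfl⟩, ?_⟩
    rintro ⟨α', β, hβ, h0, h⟩
    exact h0 (Phi_inj isBicomp_zero hβ (G_injective h)).symm

theorem mk_mem_span_A (p : Poly) :
    Ideal.Quotient.mk I (p : R) ∈ Submodule.span ℚ (Ideal.Quotient.mk I '' A) := by
  obtain ⟨ρ, hρ, hmk⟩ := exists_isReduction
  have hp : p ∈ Submodule.span ℚ (Set.range fun α => ρ (Phi α 0)) :=
    hρ.basis.2 ▸ Submodule.mem_top
  have h := Submodule.mem_map_of_mem (f := polyMk.toLinearMap) hp
  have he : polyMk.toLinearMap '' (Set.range fun α => ρ (Phi α 0)) = Ideal.Quotient.mk I '' A := by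
    rw [A_eq_range, ← Set.range_comp, ← Set.range_comp]
    exact congrArg Set.range (funext fun α => hmk _)
  rw [Submodule.map_span, he] at h
  rw [← polyMk_apply]
  exact h

theorem linearIndependent_A :
    LinearIndependent ℚ fun g : A => Ideal.Quotient.mk I (g : R) := by
  obtain ⟨ρ, hρ, hmk⟩ := exists_isReduction
  have hA : ∀ g : A, ∃ α, G (Phi α 0) = g := fun g => A_eq_range.subset g.2
  choose α hα using hA
  have hinj : Function.Injective α := fun g g' h => Subtype.ext (by rw [← hα, ← hα, h])
  have h := (hρ.basis.1.map' polyMk.toLinearMap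
    (LinearMap.ker_eq_bot.2 polyMk_injective)).comp α hinj
  have he : (polyMk.toLinearMap ∘ fun α => ρ (Phi α 0)) ∘ α =
      fun g : A => Ideal.Quotient.mk I (g : R) := by
    funext g
    rw [← hα g]
    exact hmk _
  rw [he] at h
  exact h

theorem dense_span_A :
    Dense (Submodule.span ℚ (Ideal.Quotient.mk I '' A) : Set (R ⧸ I)) := by
  have hdense : DenseRange fun p : Poly => Ideal.Quotient.mk I (p : R) :=
    DenseRange.comp (QuotientRing.isOpenQuotientMap_mk I).surjective.denseRange
      (@MvPowerSeries.WithPiTopology.denseRange_toMvPowerSeries (ℕ ⊕ ℕ) ℚ ⊥ _)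
      (QuotientRing.isOpenQuotientMap_mk I).continuous
  refine Dense.mono ?_ hdense
  rintro _ ⟨p, rfl⟩
  exact mk_mem_span_A p

end DQSym

end

theorem theorem4p4 :
    LinearIndependent ℚ (fun g : DQSym.A => Ideal.Quotient.mk DQSym.I (g : DQSym.R)) ∧
    (∀ p : MvPolynomial (ℕ ⊕ ℕ) ℚ,
      Ideal.Quotient.mk DQSym.I (p : DQSym.R) ∈
        Submodule.span ℚ (Ideal.Quotient.mk DQSym.I '' DQSym.A)) ∧
    Dense (Submodule.span ℚ (Ideal.Quotient.mk DQSym.I '' DQSym.A) :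
      Set (DQSym.R ⧸ DQSym.I)) :=
  ⟨DQSym.linearIndependent_A, DQSym.mk_mem_span_A, DQSym.dense_span_A⟩
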